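/- Let $d\ge 1$, $M\ge 2$, and let $\mathrm P$ be a probability measure on $\mathbb R^d\times[M]$, $[M]=\{1,\dots,M\}$, whose feature marginal $\mathrm P_X$ is the uniform distribution on $[0,1]^d$ and whose class probabilities $\pi_m=\mathrm P(Y=m)$ are all positive. Let $\eta_m(x)=\mathrm P(Y=m\mid X=x)$ and $\eta^w_m(x)=\frac{\eta_m(x)/\pi_m}{\sum_{l=1}^M\eta_l(x)/\pi_l}$. Assume that there are $\alpha,c_L,\beta,c_\beta>0$ such that $\|\eta(x')-\eta(x)\|_\infty\le c_L\|x'-x\|_2^\alpha$ for all $x,x'\in[0,1]^d$, and $\mathrm P_X\bigl(|\eta^w_{(1)}(x)-\eta^w_{(2)}(x)|\le t\bigr)\le c_\beta t^\beta$ for all $t>0$, where $\eta^w_{(1)}(x)\ge\eta^w_{(2)}(x)$ are the largest and second largest entries of $\eta^w(x)$. For a measurable $f:\mathbb R^d\to[M]$ let $r_{\mathrm{AM}}(f)=\frac1M\sum_{m=1}^M\mathrm P(f(X)=m\mid Y=m)$ and $\mathfrak R_{\mathrm{AM}}(f)=\sup_g r_{\mathrm{AM}}(g)-r_{\mathrm{AM}}(f)$,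 the supremum being over measurable $g:\mathbb R^d\to[M]$. Let $D_n=\{(X_i,Y_i)\}_{i=1}^n$ be an i.i.d. sample from $\mathrm P$, let $n_{(m)}$ be the number of $i$ with $Y_i=m$, let $n_{(\min)}=\min_m n_{(m)}$ be the size of the minority class and $\rho=Mn_{(\min)}/n$ the imbalance ratio. Given parameters $s\in[1,\rho n]$ and $B,k\in\mathbb N$, draw, conditionally on $D_n$, independent Bernoulli variables $Z^b_i$ ($1\le b\le B$, $1\le i\le n$) with $\mathrm P(Z^b_i=1)=s/(Mn_{(Y_i)})$, and let $D^u_b=\{(X_i,Y_i):Z^b_i=1\}$. Let $\widehat\eta^{B,u}_m(x)=\frac1B\sum_{b=1}^B\frac1k\sum_{i=1}^k\mathbf 1\{Y^{b,u}_{(i)}(x)=m\}$, where $Y^{b,u}_{(i)}(x)$ is the label of the $i$-th nearest neighbor of $x$ in $D^u_b$ in Euclidean distance (distance ties are broken by index, and missing neighbors contribute $0$). The under-bagging $k$-NN classifier $\widehat f^{B,u}$ is a measurable map with $\widehat f^{B,u}(x)\in\arg\max_{m\in[M]}\widehat\eta^{B,u}_m(x)$ for $x\in[0,1]^d$ (with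 any rule for breaking ties). Then for every $c>0$ there are a constant $C>0$ and an $N_2^*\in\mathbb N$ such that for all $n\ge N_2^*$ the following holds. Let $s$, $B$, $k$ be chosen (possibly depending on $D_n$) such that $1\le s\le\rho n$, $$s\ge c\cdot\begin{cases}(\rho n)^{d/(2\alpha+d)}(\log(\rho n))^{2\alpha/(2\alpha+d)},& d>2\alpha,\\(\rho n\log(\rho n))^{1/2},& d\le2\alpha,\end{cases}$$ and the integers $B$ and $k$ are the numbers $\rho n/s$ and $s\,\bigl(\log(\rho n)/(\rho n)\bigr)^{d/(2\alpha+d)}$, respectively, rounded up or down; this is required for every sample for which such a choice is possible (for all other samples $s,B,k$ are arbitrary, with acceptance probabilities truncated to $[0,1]$). Then $$\mathfrak R_{\mathrm{AM}}(\widehat f^{B,u})\le C\,(\log n/n)^{\alpha(\beta+1)/(2\alpha+d)}$$ with probability at least $1-5/n^2$ with respect to the joint law $\mathrm P_Z^B\otimes\mathrm P^n$ of the sample and the acceptance variables. -/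

import Mathlib

open MeasureTheory ProbabilityTheory
open scoped ENNReal

noncomputable section

/-- The cube `[0,1]^d` in Euclidean space. -/
def unitCube (d : ℕ) : Set (EuclideanSpace ℝ (Fin d)) :=
  {x | ∀ i, x i ∈ Set.Icc (0 : ℝ) 1}

/-! ### The population: class probabilities, posterior, AM measure -/

/-- `π_m = P(Y = m)`. -/
def classProb {d M : ℕ} (P : Measure (EuclideanSpace ℝ (Fin d) × Fin M)) (m : Fin M) : ℝ :=
  P.real {p | p.2 = m}

/-- `η : [0,1]^d → [0,1]^M` is (a version of) the posterior probability
`η_m(x) = P(Y = m | X = x)`, for a distribution whose features live in the unit cube.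
Values of `η` outside the cube are irrelevant. -/
structure IsPosterior {d M : ℕ} (P : Measure (EuclideanSpace ℝ (Fin d) × Fin M))
    (η : EuclideanSpace ℝ (Fin d) → Fin M → ℝ) : Prop where
  nonneg : ∀ x ∈ unitCube d, ∀ m, 0 ≤ η x m
  sum_eq_one : ∀ x ∈ unitCube d, ∑ m, η x m = 1
  disintegration : ∀ m, ∀ A ⊆ unitCube d, MeasurableSet A →
    P (A ×ˢ {m}) = ∫⁻ x in A, ENNReal.ofReal (η x m) ∂P.fst

/-- The weighted posterior `η^w_m(x) = (η_m(x)/π_m) / ∑_l η_l(x)/π_l`. -/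
def weightedPosterior {d M : ℕ} (P : Measure (EuclideanSpace ℝ (Fin d) × Fin M))
    (η : EuclideanSpace ℝ (Fin d) → Fin M → ℝ) (x : EuclideanSpace ℝ (Fin d)) (m : Fin M) : ℝ :=
  (η x m / classProb P m) / ∑ l, η x l / classProb P l

/-- The `(j+1)`-th largest entry of `v`, counted with multiplicity
(`Tuple.sort v` sorts `v` increasingly). -/
def kthLargest {M : ℕ} (v : Fin M → ℝ) (j : Fin M) : ℝ :=
  v (Tuple.sort v (Fin.rev j))

/-- `α`-Hölder continuity of the posterior on the cube with constant `cL`. -/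
def HolderPosterior {d M : ℕ} (η : EuclideanSpace ℝ (Fin d) → Fin M → ℝ) (α cL : ℝ) : Prop :=
  ∀ x ∈ unitCube d, ∀ x' ∈ unitCube d, ‖η x' - η x‖ ≤ cL * ‖x' - x‖ ^ α

/-- Margin condition with exponent `β` and constant `cβ` for the weighted posterior:
`P(|η^w_(1)(X) - η^w_(2)(X)| ≤ t) ≤ cβ t^β` for all `t > 0`. -/
def MarginCondition {d M : ℕ} (hM : 2 ≤ M) (P : Measure (EuclideanSpace ℝ (Fin d) × Fin M))
    (η : EuclideanSpace ℝ (Fin d) → Fin M → ℝ) (β cβ : ℝ) : Prop :=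
  ∀ t : ℝ, 0 < t →
    P.fst {x | |kthLargest (weightedPosterior P η x) ⟨0, by omega⟩
        - kthLargest (weightedPosterior P η x) ⟨1, by omega⟩| ≤ t}
      ≤ ENNReal.ofReal (cβ * t ^ β)

/-- Recall of class `m`: `r_m(f) = P(f(X) = m | Y = m)`. -/
def classRecall {d M : ℕ} (P : Measure (EuclideanSpace ℝ (Fin d) × Fin M))
    (f : EuclideanSpace ℝ (Fin d) → Fin M) (m : Fin M) : ℝ :=
  (ProbabilityTheory.cond P {p | p.2 = m}).real {p | f p.1 = m}

/-- `r_AM(f)`, the arithmetic mean of the recalls. -/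
def amMeasure {d M : ℕ} (P : Measure (EuclideanSpace ℝ (Fin d) × Fin M))
    (f : EuclideanSpace ℝ (Fin d) → Fin M) : ℝ :=
  (1 / (M : ℝ)) * ∑ m, classRecall P f m

/-- The AM-regret `r_AM^* - r_AM(f)`, where `r_AM^*` is the supremum over measurable classifiers. -/
def amRegret {d M : ℕ} (P : Measure (EuclideanSpace ℝ (Fin d) × Fin M))
    (f : EuclideanSpace ℝ (Fin d) → Fin M) : ℝ :=
  (⨆ g : {g : EuclideanSpace ℝ (Fin d) → Fin M // Measurable g}, amMeasure P g.1)
    - amMeasure P f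

/-! ### The sample and the under-bagging `k`-NN classifier -/

/-- A labelled sample `D_n = ((X_1,Y_1),…,(X_n,Y_n))`. -/
abbrev LabelledSample (d M n : ℕ) : Type := Fin n → EuclideanSpace ℝ (Fin d) × Fin M

/-- `n_(m)`, the number of sample points with label `m`. -/
def classCount {d M n : ℕ} (D : LabelledSample d M n) (m : Fin M) : ℕ :=
  (Finset.univ.filter fun i => (D i).2 = m).card

/-- The size of the smallest class. -/
def minorityCount {d M n : ℕ} (D : LabelledSample d M n) : ℕ :=
  ⨅ m, classCount D m

/-- The imbalance ratio `ρ = M n_(1) / n`. -/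
def imbalanceRatio {d M n : ℕ} (D : LabelledSample d M n) : ℝ :=
  (M : ℝ) * minorityCount D / n

/-- Acceptance probability `a(X_i, Y_i) = s / (M n_(Y_i))` of the `i`-th observation. -/
def acceptProb {d M n : ℕ} (D : LabelledSample d M n) (s : ℝ) (i : Fin n) : ℝ :=
  s / (M * classCount D (D i).2)

/-- Joint law `P_Z^B`, given the sample, of the acceptance indicators `Z^b_i`, `b < B`, `i < n`:
independent Bernoulli variables with parameters `a(X_i, Y_i)`. The projection to `[0,1]` does
nothing when `0 ≤ s ≤ M n_(1)`. -/
def bagLaw {d M n : ℕ} (D : LabelledSample d M n) (s : ℝ) (B : ℕ) :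
    Measure (Fin B → Fin n → Bool) :=
  Measure.pi fun _ => Measure.pi fun i =>
    bernoulliMeasure true false (Set.projIcc (0 : ℝ) 1 zero_le_one (acceptProb D s i))

/-- Number of accepted points (`z j = true`) that precede the `i`-th point in the ordering by
Euclidean distance to `x`, equal distances being ordered by index. An accepted point `i` is the
`(nnRank D z x i + 1)`-th nearest neighbour of `x` in the subsample. -/
def nnRank {d M n : ℕ} (D : LabelledSample d M n) (z : Fin n → Bool)
    (x : EuclideanSpace ℝ (Fin d)) (i : Fin n) : ℕ :=
  {j : Fin n | z j = true ∧ (dist (D j).1 x < dist (D i).1 x ∨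
    (dist (D j).1 x = dist (D i).1 x ∧ j < i))}.ncard

/-- `k`-NN posterior estimate on the subsample: `(1/k)` times the number of the `k` nearest
neighbours of `x` in the subsample that have label `m`. -/
def knnEstimate {d M n : ℕ} (D : LabelledSample d M n) (z : Fin n → Bool) (k : ℕ)
    (x : EuclideanSpace ℝ (Fin d)) (m : Fin M) : ℝ :=
  ({i : Fin n | z i = true ∧ nnRank D z x i < k ∧ (D i).2 = m}.ncard : ℝ) / k

/-- The bagged posterior estimate, the average of the `B` subsample estimates. -/
def baggedEstimate {d M n B : ℕ} (D : LabelledSample d M n) (z : Fin B → Fin n → Bool) (k : ℕ)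
    (x : EuclideanSpace ℝ (Fin d)) (m : Fin M) : ℝ :=
  (1 / (B : ℝ)) * ∑ b, knnEstimate D (z b) k x m

/-- `f` is an under-bagging `k`-NN classifier: a measurable choice of
`argmax_m` of the bagged posterior estimate, with any rule for breaking ties. -/
def IsUnderBaggingClassifier {d M n B : ℕ} (D : LabelledSample d M n)
    (z : Fin B → Fin n → Bool) (k : ℕ) (f : EuclideanSpace ℝ (Fin d) → Fin M) : Prop :=
  Measurable f ∧ ∀ x ∈ unitCube d, ∀ m, baggedEstimate D z k x m ≤ baggedEstimate D z k x (f x)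

/-! ### The choice of the parameters -/

/-- The order of the expected subsample size, as a function of `r = ρ n`. -/
def subsampleOrder (d : ℕ) (α r : ℝ) : ℝ :=
  if 2 * α < d then
    r ^ ((d : ℝ) / (2 * α + d)) * Real.log r ^ (2 * α / (2 * α + d))
  else
    (r * Real.log r) ^ (1 / 2 : ℝ)

/-- The parameters `s, B, k` are chosen as prescribed, for `r = ρ n`: `1 ≤ s ≤ ρ n`,
`s ≥ c · subsampleOrder`, and the integers `B` and `k` are `ρ n / s` and
`s (log(ρ n)/(ρ n))^{d/(2α+d)}` rounded up or down. -/
def IsParameterChoice (d : ℕ) (α c r s : ℝ) (B k : ℕ) : Prop :=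
  1 ≤ s ∧ s ≤ r ∧ c * subsampleOrder d α r ≤ s ∧
    |(B : ℝ) - r / s| < 1 ∧
    |(k : ℝ) - s * (Real.log r / r) ^ ((d : ℝ) / (2 * α + d))| < 1

end

open MeasureTheory ProbabilityTheory
open scoped ENNReal

noncomputable section

/-! ### Exponential inequalities -/

/-! The AM measure is the mean of `η_{f(x)}(x) / π_{f(x)}` up to the factor `1/M`, so it is
maximized by the argmax of `η^w`. If an estimate of `η^w` is uniformly within `δ` on the cube, its
argmax can be wrong only where the two largest entries of `η^w` differ by at most `2δ`. The loss
there is of order `δ`, and by the margin condition such points have mass of order `δ^β`. Hence the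
regret is of order `δ^(β+1)` (`amRegret_le`). It remains to reach `δ` of order `τ^α` with `τ = (log
n / n)^(1/(2α+d))`.

Fix a point `x` and scan the sample by distance to `x`. In one bag, a point is visited as long as
fewer than `k` points have been accepted before it. The number of accepted points of class `m` among
the nearest neighbours is a martingale term plus its compensator, which is `s / (M n_(m))` times the
number of visited points of class `m`. The visited points fill a ball of random radius. If all
counts in balls are close to their means, the Hölder condition makes the visited number about `n
η_m(x) v`, with `v` the mass of the ball, the same for every class. As `n_(m)` is about `n π_m`, the
compensator is about `(s/M) v η_m(x)/π_m`. The unknown factor `v` disappears after averaging over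
bags and normalizing, because the counts of all classes add up to `k` (`abs_normalize_sub_le`,
`abs_baggedEstimate_sub_le`).

Two sources of randomness have to be controlled uniformly in `x`. Counts of the sample in balls are
handled by Chernoff bounds on a polynomial grid of balls (`sampleCount_ball_of_grid`,
`eventually_goodSample`). Given the sample, the martingale terms of the independent bags are summed
and bounded by an exponential supermartingale (`integral_predictable_exp_le`). Only the distance
ordering seen from `x` matters here, and a Vapnik–Chervonenkis argument leaves polynomially many
orderings (`exists_representatives`). Since `B s` is of order `n`, the averaged martingale error has
the precision of the full sample. The lower bound on `s` makes `k` at least of order `log n`, so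
that every bag finds its `k` neighbours within radius of order `τ`. -/

lemma Real.exp_le_one_add_add_sq {u : ℝ} (hu : |u| ≤ 1) : Real.exp u ≤ 1 + u + u ^ 2 := by
  have := (abs_le.1 (Real.abs_exp_sub_one_sub_id_le hu)).2
  linarith

/-- The centred two-point distribution is sub-exponential with variance proxy `p`. -/
lemma two_point_exp_le {p u : ℝ} (hp0 : 0 ≤ p) (hu : |u| ≤ 1) :
    p * Real.exp (u * (1 - p)) + (1 - p) * Real.exp (u * (0 - p)) ≤ Real.exp (u ^ 2 * p) := by
  have h1 : p * Real.exp (u * (1 - p)) + (1 - p) * Real.exp (u * (0 - p))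
      = Real.exp (-(u * p)) * (p * (Real.exp u - 1) + 1) := by
    rw [show u * (1 - p) = -(u * p) + u by ring, show u * (0 - p) = -(u * p) by ring,
      Real.exp_add]
    ring
  -- The linear term `p * u` of this exponent is cancelled by the centring factor `exp (-(u * p))`,
  -- leaving the variance proxy.
  have h2 : p * (Real.exp u - 1) + 1 ≤ Real.exp (p * (u + u ^ 2)) := by
    refine le_trans ?_ (Real.add_one_le_exp _)
    have := mul_le_mul_of_nonneg_left (Real.exp_le_one_add_add_sq hu) hp0
    linarith
  rw [h1, show u ^ 2 * p = -(u * p) + p * (u + u ^ 2) by ring, Real.exp_add]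
  exact mul_le_mul_of_nonneg_left h2 (Real.exp_pos _).le

/-- Chernoff bound for sums over the coordinates of a product measure. -/
lemma measureReal_pi_abs_sum_ge_le {ι : Type*} [Fintype ι] {E : ι → Type*}
    [∀ i, MeasurableSpace (E i)] (μ : ∀ i, Measure (E i)) [∀ i, IsProbabilityMeasure (μ i)]
    (g : ∀ i, E i → ℝ) (hg : ∀ i, Measurable (g i)) {R : ℝ} (hR : ∀ i x, |g i x| ≤ R)
    (v : ι → ℝ) (hv : ∀ i, ∀ θ : ℝ, |θ| ≤ 1 →
      ∫ x, Real.exp (θ * g i x) ∂(μ i) ≤ Real.exp (θ ^ 2 * v i))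
    {V t : ℝ} (hV : ∑ i, v i ≤ V) (hV0 : 0 < V) (ht : 0 ≤ t) (htV : t ≤ 2 * V) :
    (Measure.pi μ).real {x | t ≤ |∑ i, g i (x i)|} ≤ 2 * Real.exp (-(t ^ 2 / (4 * V))) := by
  -- The minimizer of `θ ^ 2 * V - θ * t`; the assumption `t ≤ 2 * V` keeps it in the range where
  -- `hv` applies.
  set θ : ℝ := t / (2 * V) with hθ
  have hθ0 : 0 ≤ θ := by positivity
  have hθ1 : θ ≤ 1 := by rw [hθ, div_le_one (by positivity)]; exact htV
  have key : ∀ σ : ℝ, |σ| = 1 → (Measure.pi μ).real {x | t ≤ σ * ∑ i, g i (x i)}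
      ≤ Real.exp (-(t ^ 2 / (4 * V))) := by
    intro σ hσ
    have hm : Measurable fun x : (∀ i, E i) => σ * ∑ i, g i (x i) := by fun_prop
    have hbd : ∀ x : (∀ i, E i), |σ * ∑ i, g i (x i)| ≤ ∑ i : ι, R := fun x => by
      rw [abs_mul, hσ, one_mul]
      exact (Finset.abs_sum_le_sum_abs _ _).trans (Finset.sum_le_sum fun i _ => hR i _)
    have hint : Integrable (fun x : (∀ i, E i) => Real.exp (θ * (σ * ∑ i, g i (x i))))
        (Measure.pi μ) := by
      refine Integrable.of_bound (C := Real.exp (θ * ∑ i : ι, R))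
        (Real.measurable_exp.comp (hm.const_mul θ)).aestronglyMeasurable ?_
      refine Filter.Eventually.of_forall fun x => ?_
      rw [Real.norm_eq_abs, Real.abs_exp, Real.exp_le_exp]
      exact mul_le_mul_of_nonneg_left ((le_abs_self _).trans (hbd x)) hθ0
    refine (measure_ge_le_exp_mul_mgf t hθ0 hint).trans ?_
    have hmgf : mgf (fun x : (∀ i, E i) => σ * ∑ i, g i (x i)) (Measure.pi μ) θ
        ≤ Real.exp (θ ^ 2 * V) := by
      have : mgf (fun x : (∀ i, E i) => σ * ∑ i, g i (x i)) (Measure.pi μ) θ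
          = ∏ i, ∫ x, Real.exp ((θ * σ) * g i x) ∂(μ i) := by
        rw [← integral_fintype_prod_eq_prod (𝕜 := ℝ) (fun i x => Real.exp ((θ * σ) * g i x)), mgf]
        congr 1
        ext x
        rw [← Real.exp_sum, ← Finset.mul_sum]
        ring_nf
      rw [this]
      have hθσ : |θ * σ| ≤ 1 := by rw [abs_mul, hσ, abs_of_nonneg hθ0]; linarith
      have hσ2 : σ ^ 2 = 1 := by rw [← sq_abs, hσ, one_pow]
      calc ∏ i, ∫ x, Real.exp ((θ * σ) * g i x) ∂(μ i)
          ≤ ∏ i, Real.exp ((θ * σ) ^ 2 * v i) :=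
            Finset.prod_le_prod (fun i _ => integral_nonneg fun x => (Real.exp_pos _).le)
              fun i _ => hv i _ hθσ
        _ = Real.exp (θ ^ 2 * ∑ i, v i) := by
            rw [← Real.exp_sum, ← Finset.mul_sum, mul_pow, hσ2, mul_one]
        _ ≤ _ := Real.exp_le_exp.2 (mul_le_mul_of_nonneg_left hV (sq_nonneg _))
    refine (mul_le_mul_of_nonneg_left hmgf (Real.exp_pos _).le).trans ?_
    rw [← Real.exp_add, Real.exp_le_exp, hθ]
    apply le_of_eq
    field_simp
    ring
  have hsub : {x : (∀ i, E i) | t ≤ |∑ i, g i (x i)|} ⊆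
      {x | t ≤ 1 * ∑ i, g i (x i)} ∪ {x | t ≤ (-1) * ∑ i, g i (x i)} := by
    intro x hx
    rcases le_abs.1 (show t ≤ |∑ i, g i (x i)| from hx) with h | h
    · left; simpa using h
    · right; simpa using h
  refine (measureReal_mono hsub).trans ((measureReal_union_le _ _).trans ?_)
  have h1 := key 1 (by simp)
  have h2 := key (-1) (by simp)
  linarith

/-- Bernstein-type bound for the number of points of an i.i.d. sample in a set. -/
lemma measureReal_pi_count_le {Ω : Type*} [MeasurableSpace Ω] (P : Measure Ω)
    [IsProbabilityMeasure P] (n : ℕ) {A : Set Ω} (hA : MeasurableSet A) {q t : ℝ}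
    (hq : P.real A ≤ q) (hq0 : 0 < q) (hn : 0 < n) (ht : 0 ≤ t) (htq : t ≤ 2 * (n * q)) :
    (Measure.pi fun _ : Fin n => P).real
      {D | t ≤ |∑ i, A.indicator (fun _ => (1 : ℝ)) (D i) - n * P.real A|}
      ≤ 2 * Real.exp (-(t ^ 2 / (4 * (n * q)))) := by
  set p := P.real A with hp
  have hp0 : 0 ≤ p := measureReal_nonneg
  have hp1 : p ≤ 1 := measureReal_le_one
  have hn' : (0 : ℝ) < n := by exact_mod_cast hn
  have hgm : Measurable fun x : Ω => A.indicator (fun _ => (1 : ℝ)) x - p :=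
    (measurable_const.indicator hA).sub measurable_const
  have := measureReal_pi_abs_sum_ge_le (fun _ : Fin n => P)
    (fun _ x => A.indicator (fun _ => (1 : ℝ)) x - p) (fun _ => hgm) (R := 1)
    (by
      intro _ x
      by_cases hx : x ∈ A <;> simp only [hx, Set.indicator_of_mem, Set.indicator_of_notMem,
        not_false_eq_true, abs_le] <;> constructor <;> linarith)
    (fun _ => p)
    (by
      intro _ θ hθ
      refine le_trans (le_of_eq ?_) (two_point_exp_le hp0 hθ)
      have h1 : (fun x => Real.exp (θ * (A.indicator (fun _ => (1 : ℝ)) x - p)))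
          = fun x => A.indicator (fun _ => Real.exp (θ * (1 - p))) x
            + Aᶜ.indicator (fun _ => Real.exp (θ * (0 - p))) x := by
        ext x
        by_cases hx : x ∈ A <;> simp [hx]
      rw [h1, integral_add ((integrable_const _).indicator hA)
        ((integrable_const _).indicator hA.compl), integral_indicator_const _ hA,
        integral_indicator_const _ hA.compl, probReal_compl_eq_one_sub hA, ← hp]
      simp)
    (V := n * q) (t := t)
    (by simpa using mul_le_mul_of_nonneg_left hq hn'.le) (by positivity) ht htq
  simpa using this

/-! ### Predictable sums of Bernoulli variables -/

/-- The indicator of `true`. -/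
def boolReal (b : Bool) : ℝ := if b = true then 1 else 0

lemma lintegral_bernoulli_exp_le (p : unitInterval) {u : ℝ} (hu : |u| ≤ 1) :
    ∫⁻ b, ENNReal.ofReal (Real.exp (u * (boolReal b - p))) ∂(bernoulliMeasure true false p)
      ≤ ENNReal.ofReal (Real.exp (u ^ 2 * p)) := by
  refine le_trans (le_of_eq ?_) (ENNReal.ofReal_le_ofReal (two_point_exp_le p.2.1 hu))
  rw [← ofReal_integral_eq_lintegral_ofReal]
  · rw [integral_bernoulliMeasure]
    simp [boolReal]
  · exact Integrable.of_finite
  · exact Filter.Eventually.of_forall fun b => (Real.exp_pos _).le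

/-- Exponential supermartingale bound for sums of centred Bernoulli variables with
predictable coefficients `ξ i`, the coordinates being ordered by `κ`. -/
lemma lintegral_predictable_exp_le {ι : Type*} [Fintype ι] [DecidableEq ι]
    (p : ι → unitInterval) (κ : ι → ℕ) (ξ : ι → (ι → Bool) → ℝ) (hξ1 : ∀ i z, |ξ i z| ≤ 1)
    (hξ : ∀ i j z b, κ i ≤ κ j → ξ i (Function.update z j b) = ξ i z)
    {θ : ℝ} (hθ : |θ| ≤ 1) (W : Finset ι) (hκ : Set.InjOn κ W) :
    ∫⁻ z, ENNReal.ofReal (Real.exp (θ * ∑ i ∈ W, (boolReal (z i) - p i) * ξ i z))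
        ∂(Measure.pi fun i => bernoulliMeasure true false (p i))
      ≤ ENNReal.ofReal (Real.exp (θ ^ 2 * ∑ i ∈ W, (p i : ℝ))) := by
  -- The last coordinate `a` in the order `κ` is peeled off: the earlier terms and the coefficient
  -- `ξ a` do not depend on `z a`, so integrating over that coordinate alone costs a deterministic
  -- factor.
  induction W using Finset.induction_on_max_value κ with
  | empty => simp
  | insert a s has hmax ih =>
    have ih' := ih (hκ.mono (by simp))
    set F : (ι → Bool) → ℝ≥0∞ := fun z =>
      ENNReal.ofReal (Real.exp (θ * ∑ i ∈ s, (boolReal (z i) - p i) * ξ i z)) with hF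
    set K : ℝ≥0∞ := ENNReal.ofReal (Real.exp (θ ^ 2 * p a)) with hK
    have hFu : ∀ z b, F (Function.update z a b) = F z := by
      intro z b
      simp only [hF]
      congr 3
      refine Finset.sum_congr rfl fun i hi => ?_
      have hne : i ≠ a := fun h => has (h ▸ hi)
      rw [hξ i a z b (hmax i hi), Function.update_of_ne hne]
    calc ∫⁻ z, ENNReal.ofReal (Real.exp (θ * ∑ i ∈ insert a s, (boolReal (z i) - p i) * ξ i z))
          ∂(Measure.pi fun i => bernoulliMeasure true false (p i))
        ≤ ∫⁻ z, F z * K ∂(Measure.pi fun i => bernoulliMeasure true false (p i)) := by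
          refine lintegral_le_of_lmarginal_le {a} (measurable_of_finite _)
            (measurable_of_finite _) ?_
          rw [lmarginal_singleton, lmarginal_singleton]
          intro z
          simp only [hFu, lintegral_const, measure_univ, mul_one]
          have : ∀ b, ENNReal.ofReal (Real.exp (θ * ∑ i ∈ insert a s,
              (boolReal (Function.update z a b i) - p i) * ξ i (Function.update z a b)))
              = F z * ENNReal.ofReal (Real.exp ((θ * ξ a z) * (boolReal b - p a))) := by
            intro b
            rw [← hFu z b, hF, ← ENNReal.ofReal_mul (Real.exp_pos _).le, ← Real.exp_add,
              Finset.sum_insert has, hξ a a z b le_rfl, Function.update_self]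
            congr 2
            ring
          simp only [this]
          rw [lintegral_const_mul _ (measurable_of_finite _)]
          gcongr
          refine (lintegral_bernoulli_exp_le (p a) ?_).trans ?_
          · rw [abs_mul]
            exact mul_le_one₀ hθ (abs_nonneg _) (hξ1 a z)
          · refine ENNReal.ofReal_le_ofReal (Real.exp_le_exp.2 ?_)
            refine mul_le_mul_of_nonneg_right ?_ (p a).2.1
            rw [mul_pow]
            have : ξ a z ^ 2 ≤ 1 := by rw [← sq_abs]; exact pow_le_one₀ (abs_nonneg _) (hξ1 a z)
            nlinarith [sq_nonneg θ]
      _ = (∫⁻ z, F z ∂(Measure.pi fun i => bernoulliMeasure true false (p i))) * K :=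
          lintegral_mul_const _ (measurable_of_finite _)
      _ ≤ ENNReal.ofReal (Real.exp (θ ^ 2 * ∑ i ∈ s, (p i : ℝ))) * K := by gcongr
      _ = _ := by
          rw [hK, ← ENNReal.ofReal_mul (Real.exp_pos _).le, ← Real.exp_add, Finset.sum_insert has]
          congr 2
          ring

lemma integral_predictable_exp_le {ι : Type*} [Fintype ι] [DecidableEq ι]
    (p : ι → unitInterval) (κ : ι → ℕ) (ξ : ι → (ι → Bool) → ℝ) (hξ1 : ∀ i z, |ξ i z| ≤ 1)
    (hξ : ∀ i j z b, κ i ≤ κ j → ξ i (Function.update z j b) = ξ i z)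
    {θ : ℝ} (hθ : |θ| ≤ 1) (W : Finset ι) (hκ : Set.InjOn κ W) :
    ∫ z, Real.exp (θ * ∑ i ∈ W, (boolReal (z i) - p i) * ξ i z)
        ∂(Measure.pi fun i => bernoulliMeasure true false (p i))
      ≤ Real.exp (θ ^ 2 * ∑ i ∈ W, (p i : ℝ)) := by
  rw [← ENNReal.ofReal_le_ofReal_iff (Real.exp_pos _).le, ofReal_integral_eq_lintegral_ofReal]
  · exact lintegral_predictable_exp_le p κ ξ hξ1 hξ hθ W hκ
  · exact Integrable.of_finite
  · exact Filter.Eventually.of_forall fun b => (Real.exp_pos _).le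

/-! ### The number of distance orderings -/

lemma sum_choose_le_add_one_pow (N D : ℕ) : ∑ k ∈ Finset.Iic D, N.choose k ≤ (N + 1) ^ D := by
  rw [add_pow]
  have : Finset.Iic D = Finset.range (D + 1) := by ext; simp
  rw [this]
  refine Finset.sum_le_sum fun k hk => ?_
  have hk' : k ≤ D := by simpa [Nat.lt_succ_iff] using hk
  simp only [one_pow, mul_one]
  exact (Nat.choose_le_pow N k).trans (Nat.le_mul_of_pos_right _ (Nat.choose_pos hk'))

/-- Half-spaces through the origin have VC dimension at most the dimension of the space. -/
lemma vcDim_halfspaces_le {α W : Type*} [Fintype α] [DecidableEq α] [AddCommGroup W] [Module ℝ W]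
    [FiniteDimensional ℝ W] (v : α → W) (𝒜 : Finset (Finset α))
    (h𝒜 : ∀ S ∈ 𝒜, ∃ φ : W →ₗ[ℝ] ℝ, ∀ a, a ∈ S ↔ φ (v a) < 0) :
    𝒜.vcDim ≤ Module.finrank ℝ W := by
  refine Finset.sup_le fun s hs => ?_
  rw [Finset.mem_shatterer] at hs
  by_contra hlt
  -- A shattered set larger than the dimension carries a linear relation. Picking out exactly its
  -- positive coefficients by a half-space makes every term of the relation nonpositive under `φ`
  -- and one of them negative, although the sum is zero.
  have hdep : ¬ LinearIndependent ℝ (fun a : s => v a) := by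
    intro hli
    have := hli.fintype_card_le_finrank
    simp at this
    omega
  obtain ⟨g, hg0, i, hi⟩ := Fintype.not_linearIndependent_iff.1 hdep
  have main : ∀ g : s → ℝ, ∑ a, g a • v a = 0 → ∀ i, 0 < g i → False := by
    intro g hg0 i hi
    obtain ⟨S, hS, hSt⟩ := hs (t := (Finset.univ.filter fun a : s => 0 < g a).map
      (Function.Embedding.subtype _)) (by
        intro a ha
        simp only [Finset.mem_map, Finset.mem_filter, Finset.mem_univ, true_and] at ha
        obtain ⟨b, _, rfl⟩ := ha
        exact b.2)
    obtain ⟨φ, hφ⟩ := h𝒜 S hS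
    have hmem : ∀ a : s, (φ (v a) < 0 ↔ 0 < g a) := by
      intro a
      rw [← hφ]
      have h1 : (a : α) ∈ s ∩ S ↔ (a : α) ∈ S := by simp
      rw [← h1, hSt]
      simp
    have hsum : ∑ a, g a * φ (v a) = 0 := by
      have := congrArg φ hg0
      simpa using this
    have hneg : ∑ a, g a * φ (v a) < ∑ a : s, (0 : ℝ) := by
      refine Finset.sum_lt_sum (fun a _ => ?_) ⟨i, Finset.mem_univ _, ?_⟩
      · by_cases ha : 0 < g a
        · exact (mul_neg_of_pos_of_neg ha ((hmem a).2 ha)).le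
        · exact mul_nonpos_of_nonpos_of_nonneg (not_lt.1 ha)
            (not_lt.1 fun h => ha ((hmem a).1 h))
      · exact mul_neg_of_pos_of_neg hi ((hmem i).2 hi)
    rw [hsum, Finset.sum_const_zero] at hneg
    exact hneg.false
  rcases lt_or_gt_of_ne hi with h | h
  · refine main (fun a => - g a) ?_ i (by linarith)
    simp only [neg_smul, Finset.sum_neg_distrib, hg0, neg_zero]
  · exact main g hg0 i h

/-- Finitely many points, polynomially many in `n`, realize all orderings of `n` points by their
distance. -/
lemma exists_representatives {d n : ℕ} (X : Fin n → EuclideanSpace ℝ (Fin d)) :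
    ∃ X₀ : Finset (EuclideanSpace ℝ (Fin d)), X₀.card ≤ (n ^ 2 + 1) ^ (d + 1) ∧
      ∀ x, ∃ x₀ ∈ X₀, ∀ j i, (dist (X j) x < dist (X i) x ↔ dist (X j) x₀ < dist (X i) x₀) := by
  classical
  let E := EuclideanSpace ℝ (Fin d)
  let Q : E → Finset (Fin n × Fin n) := fun x =>
    Finset.univ.filter fun a => dist (X a.1) x < dist (X a.2) x
  have hfin : (Set.range Q).Finite := Set.toFinite _
  let 𝒜 : Finset (Finset (Fin n × Fin n)) := hfin.toFinset
  -- Comparing two squared distances to `x`, the term `‖x‖ ^ 2` cancels and an affine condition in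
  -- `x` remains. The additional real coordinate carries its constant part, so each pattern `Q x` is
  -- cut out by a half-space through the origin of `E × ℝ`.
  let v : Fin n × Fin n → E × ℝ := fun a => (X a.1 - X a.2, ‖X a.1‖ ^ 2 - ‖X a.2‖ ^ 2)
  have hvc : 𝒜.vcDim ≤ d + 1 := by
    have := vcDim_halfspaces_le v 𝒜 (by
      intro S hS
      obtain ⟨x, rfl⟩ := hfin.mem_toFinset.1 hS
      refine ⟨LinearMap.snd ℝ E ℝ - (2 : ℝ) • ((innerSL ℝ x).toLinearMap ∘ₗ LinearMap.fst ℝ E ℝ),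
        fun a => ?_⟩
      have h1 : ∀ y : E, dist y x ^ 2 = ‖y‖ ^ 2 - 2 * inner ℝ x y + ‖x‖ ^ 2 := by
        intro y
        rw [dist_eq_norm, norm_sub_sq_real, real_inner_comm]
      have h2 : dist (X a.1) x < dist (X a.2) x ↔ dist (X a.1) x ^ 2 < dist (X a.2) x ^ 2 :=
        (pow_lt_pow_iff_left₀ dist_nonneg dist_nonneg two_ne_zero).symm
      simp only [Q, Finset.mem_filter, Finset.mem_univ, true_and, h2, h1, v]
      simp only [LinearMap.sub_apply, LinearMap.snd_apply, LinearMap.smul_apply,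
        LinearMap.comp_apply, LinearMap.fst_apply, ContinuousLinearMap.coe_coe, innerSL_apply_apply,
        inner_sub_right, smul_eq_mul]
      constructor <;> intro h <;> linarith)
    refine this.trans (le_of_eq ?_)
    simp [E, Module.finrank_prod]
  have hcard : 𝒜.card ≤ (n ^ 2 + 1) ^ (d + 1) := by
    -- Sauer–Shelah on the `n ^ 2` pairs of indices.
    refine (Finset.card_le_card_shatterer 𝒜).trans
      (Finset.card_shatterer_le_sum_vcDim.trans ((sum_choose_le_add_one_pow _ _).trans ?_))
    have : Fintype.card (Fin n × Fin n) = n ^ 2 := by simp [sq]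
    rw [this]
    exact Nat.pow_le_pow_right (by omega) hvc
  have hch : ∀ S ∈ 𝒜, ∃ x, Q x = S := fun S hS => hfin.mem_toFinset.1 hS
  choose! r hr using hch
  refine ⟨𝒜.image r, Finset.card_image_le.trans hcard, fun x => ?_⟩
  have hx : Q x ∈ 𝒜 := hfin.mem_toFinset.2 ⟨x, rfl⟩
  refine ⟨r (Q x), Finset.mem_image_of_mem _ hx, fun j i => ?_⟩
  have := hr _ hx
  have h3 : (j, i) ∈ Q (r (Q x)) ↔ (j, i) ∈ Q x := by rw [this]
  simpa [Q] using h3.symm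

/-! ### Ranks -/

section Rank

variable {d M n : ℕ} (D : LabelledSample d M n)

/-- `j` precedes `i` in the ordering by distance to `x`, ties being broken by index. -/
def Precedes (x : EuclideanSpace ℝ (Fin d)) (j i : Fin n) : Prop :=
  dist (D j).1 x < dist (D i).1 x ∨ (dist (D j).1 x = dist (D i).1 x ∧ j < i)

variable {D} in
lemma Precedes.trans {x : EuclideanSpace ℝ (Fin d)} {i j l : Fin n} (h1 : Precedes D x i j)
    (h2 : Precedes D x j l) : Precedes D x i l := by
  unfold Precedes at *
  rcases h1 with h1 | ⟨h1, h1'⟩ <;> rcases h2 with h2 | ⟨h2, h2'⟩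
  · exact Or.inl (h1.trans h2)
  · exact Or.inl (h2 ▸ h1)
  · exact Or.inl (h1 ▸ h2)
  · exact Or.inr ⟨h1.trans h2, h1'.trans h2'⟩

lemma precedes_irrefl (x : EuclideanSpace ℝ (Fin d)) (i : Fin n) : ¬ Precedes D x i i := by
  simp [Precedes]

lemma precedes_or_eq_or (x : EuclideanSpace ℝ (Fin d)) (i j : Fin n) :
    Precedes D x i j ∨ i = j ∨ Precedes D x j i := by
  unfold Precedes
  rcases lt_trichotomy (dist (D i).1 x) (dist (D j).1 x) with h | h | h
  · exact Or.inl (Or.inl h)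
  · rcases lt_trichotomy i j with h' | h' | h'
    · exact Or.inl (Or.inr ⟨h, h'⟩)
    · exact Or.inr (Or.inl h')
    · exact Or.inr (Or.inr (Or.inr ⟨h.symm, h'⟩))
  · exact Or.inr (Or.inr (Or.inl h))

lemma nnRank_eq (z : Fin n → Bool) (x : EuclideanSpace ℝ (Fin d)) (i : Fin n) :
    nnRank D z x i = {j | z j = true ∧ Precedes D x j i}.ncard := rfl

variable {D} in
lemma nnRank_le_of_precedes (z : Fin n → Bool) {x : EuclideanSpace ℝ (Fin d)} {i j : Fin n}
    (h : Precedes D x i j) : nnRank D z x i ≤ nnRank D z x j := by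
  rw [nnRank_eq, nnRank_eq]
  exact Set.ncard_le_ncard (fun l hl => ⟨hl.1, hl.2.trans h⟩) (Set.toFinite _)

variable {D} in
lemma nnRank_lt_of_precedes {z : Fin n → Bool} {x : EuclideanSpace ℝ (Fin d)} {i j : Fin n}
    (hz : z i = true) (h : Precedes D x i j) : nnRank D z x i < nnRank D z x j := by
  rw [nnRank_eq, nnRank_eq]
  refine Set.ncard_lt_ncard ⟨fun l hl => ⟨hl.1, hl.2.trans h⟩, fun hsub => ?_⟩ (Set.toFinite _)
  exact precedes_irrefl D x i (hsub (show i ∈ {l | z l = true ∧ Precedes D x l j} from ⟨hz, h⟩)).2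

lemma precedes_of_nnRank_lt {z : Fin n → Bool} {x : EuclideanSpace ℝ (Fin d)} {i j : Fin n}
    (h : nnRank D z x i < nnRank D z x j) : Precedes D x i j := by
  rcases precedes_or_eq_or D x i j with h' | h' | h'
  · exact h'
  · exact absurd h (by simp [h'])
  · exact absurd (nnRank_le_of_precedes z h') (by omega)

lemma nnRank_injOn (z : Fin n → Bool) (x : EuclideanSpace ℝ (Fin d)) :
    Set.InjOn (nnRank D z x) {i | z i = true} := by
  intro i hi j hj h
  rcases precedes_or_eq_or D x i j with h' | h' | h'
  · exact absurd (nnRank_lt_of_precedes hi h') (by omega)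
  · exact h'
  · exact absurd (nnRank_lt_of_precedes hj h') (by omega)

/-- Exactly `k` accepted points have fewer than `k` predecessors among the accepted ones. -/
lemma card_filter_nnRank_lt (z : Fin n → Bool) (x : EuclideanSpace ℝ (Fin d)) {k : ℕ}
    (hk : k ≤ (Finset.univ.filter fun i => z i = true).card) :
    (Finset.univ.filter fun i => z i = true ∧ nnRank D z x i < k).card = k := by
  set A := Finset.univ.filter fun i => z i = true with hA
  have hinj : Set.InjOn (nnRank D z x) A := by
    intro i hi j hj h
    exact nnRank_injOn D z x (by simpa [hA] using hi) (by simpa [hA] using hj) h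
  -- Ranks of accepted points are distinct and smaller than `A.card`, hence they take all these
  -- values.
  have himg : A.image (nnRank D z x) = Finset.range A.card := by
    refine Finset.eq_of_subset_of_card_le ?_ ?_
    · intro r hr
      obtain ⟨i, hi, rfl⟩ := Finset.mem_image.1 hr
      rw [Finset.mem_range, nnRank_eq]
      have : {j | z j = true ∧ Precedes D x j i} ⊂ (A : Set (Fin n)) := by
        refine ⟨fun j hj => by simpa [hA] using hj.1, fun hsub => ?_⟩
        exact precedes_irrefl D x i (hsub hi).2
      simpa using Set.ncard_lt_ncard this (Set.toFinite _)
    · rw [Finset.card_image_of_injOn hinj, Finset.card_range]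
  have h2 : (A.filter fun i => nnRank D z x i < k).image (nnRank D z x) = Finset.range k := by
    ext r
    simp only [Finset.mem_image, Finset.mem_filter, Finset.mem_range]
    constructor
    · rintro ⟨i, ⟨_, h⟩, rfl⟩
      exact h
    · intro hr
      have : r ∈ A.image (nnRank D z x) := by rw [himg, Finset.mem_range]; omega
      obtain ⟨i, hi, rfl⟩ := Finset.mem_image.1 this
      exact ⟨i, ⟨hi, hr⟩, rfl⟩
  rw [← Finset.filter_filter, ← Finset.card_image_of_injOn (f := nnRank D z x)
    (hinj.mono (by intro i hi; exact (Finset.mem_filter.1 hi).1)), h2, Finset.card_range]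

/-- The first `T` points in the ordering by distance to `x`. -/
def firstPoints (x : EuclideanSpace ℝ (Fin d)) (T : ℕ) : Finset (Fin n) :=
  Finset.univ.filter fun i => nnRank D (fun _ => true) x i < T

lemma card_firstPoints (x : EuclideanSpace ℝ (Fin d)) {T : ℕ} (hT : T ≤ n) :
    (firstPoints D x T).card = T := by
  have := card_filter_nnRank_lt D (fun _ => true) x (k := T) (by simpa using hT)
  simpa [firstPoints] using this

/-- A point outside the first `T` comes after all the accepted ones among them, so it already has
`k` accepted predecessors. This confines a bag's neighbours to a window that does not depend on the
bag. -/
lemma mem_firstPoints_of_nnRank_lt {z : Fin n → Bool} {x : EuclideanSpace ℝ (Fin d)} {T k : ℕ}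
    (hk : k ≤ ((firstPoints D x T).filter fun i => z i = true).card) {i : Fin n}
    (hi : nnRank D z x i < k) : i ∈ firstPoints D x T := by
  by_contra hiW
  have hiT : T ≤ nnRank D (fun _ => true) x i := by simpa [firstPoints] using hiW
  have : (((firstPoints D x T).filter fun i => z i = true : Finset (Fin n)) : Set (Fin n)) ⊆
      {j | z j = true ∧ Precedes D x j i} := by
    intro j hj
    simp only [firstPoints, Finset.coe_filter, Finset.mem_filter, Finset.mem_univ, true_and,
      Set.mem_ofPred_eq] at hj
    exact ⟨hj.2, precedes_of_nnRank_lt D (z := fun _ => true) (by omega)⟩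
  have h2 := Set.ncard_le_ncard this (Set.toFinite _)
  rw [Set.ncard_coe_finset, ← nnRank_eq] at h2
  omega

/-- Predictability: only points strictly before `i` enter its rank, so `i` itself and later points
may be resampled. This feeds the supermartingale bound. -/
lemma nnRank_update (z : Fin n → Bool) (x : EuclideanSpace ℝ (Fin d)) {i j : Fin n} (b : Bool)
    (h : nnRank D (fun _ => true) x i ≤ nnRank D (fun _ => true) x j) :
    nnRank D (Function.update z j b) x i = nnRank D z x i := by
  rw [nnRank_eq, nnRank_eq]
  congr 1
  ext l
  simp only [Set.mem_ofPred_eq]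
  refine and_congr_left fun hl => ?_
  have hne : l ≠ j := by
    rintro rfl
    exact absurd (nnRank_lt_of_precedes (z := fun _ => true) rfl hl) (by omega)
  rw [Function.update_of_ne hne]

variable {D} in
-- Strict comparisons determine the ties as well, since equality is the failure of both strict
-- inequalities.
lemma nnRank_congr {x x₀ : EuclideanSpace ℝ (Fin d)}
    (h : ∀ j i, (dist (D j).1 x < dist (D i).1 x ↔ dist (D j).1 x₀ < dist (D i).1 x₀))
    (z : Fin n → Bool) (i : Fin n) : nnRank D z x i = nnRank D z x₀ i := by
  have heq : ∀ j, (dist (D j).1 x = dist (D i).1 x ↔ dist (D j).1 x₀ = dist (D i).1 x₀) := by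
    intro j
    have h1 := not_congr (h j i)
    have h2 := not_congr (h i j)
    rw [not_lt, not_lt] at h1 h2
    rw [le_antisymm_iff, le_antisymm_iff, h1, h2]
  unfold nnRank
  simp only [h, heq]

/-- A nonempty initial segment of the distance ordering lies between an open and a closed ball. -/
lemma exists_radius (z : Fin n → Bool) (x : EuclideanSpace ℝ (Fin d)) {k : ℕ} {i₀ : Fin n}
    (hi₀ : nnRank D z x i₀ < k) :
    ∃ i₁, nnRank D z x i₁ < k ∧
      (∀ i, nnRank D z x i < k → dist (D i).1 x ≤ dist (D i₁).1 x) ∧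
      (∀ i, dist (D i).1 x < dist (D i₁).1 x → nnRank D z x i < k) := by
  obtain ⟨i₁, h1, h2⟩ := Finset.exists_max_image
    (Finset.univ.filter fun i => nnRank D z x i < k) (fun i => dist (D i).1 x)
    ⟨i₀, by simpa using hi₀⟩
  simp only [Finset.mem_filter, Finset.mem_univ, true_and] at h1 h2
  refine ⟨i₁, h1, h2, fun i hi => ?_⟩
  exact lt_of_le_of_lt (nnRank_le_of_precedes z (Or.inl hi)) h1

end Rank

/-! ### Population quantities -/

lemma isClosed_unitCube (d : ℕ) : IsClosed (unitCube d) := by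
  have : unitCube d = ⋂ i, {x : EuclideanSpace ℝ (Fin d) | x i ∈ Set.Icc (0 : ℝ) 1} := by
    ext; simp [unitCube]
  rw [this]
  refine isClosed_iInter fun i => ?_
  exact isClosed_Icc.preimage (by fun_prop : Continuous fun x : EuclideanSpace ℝ (Fin d) => x i)

lemma measurableSet_unitCube (d : ℕ) : MeasurableSet (unitCube d) :=
  (isClosed_unitCube d).measurableSet

lemma HolderPosterior.continuousOn {d M : ℕ} {η : EuclideanSpace ℝ (Fin d) → Fin M → ℝ}
    {α cL : ℝ} (h : HolderPosterior η α cL) (hα : 0 < α) :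
    ContinuousOn η (unitCube d) := by
  intro x hx
  rw [ContinuousWithinAt, tendsto_iff_norm_sub_tendsto_zero]
  refine squeeze_zero' (Filter.Eventually.of_forall fun _ => norm_nonneg _)
    (g := fun y => cL * ‖y - x‖ ^ α) ?_ ?_
  · filter_upwards [self_mem_nhdsWithin] with y hy using h x hx y hy
  · have h1 : Filter.Tendsto (fun y => cL * ‖y - x‖ ^ α) (nhds x) (nhds (cL * ‖x - x‖ ^ α)) := by
      refine Filter.Tendsto.const_mul _ (Filter.Tendsto.rpow_const ?_ (Or.inr hα.le))
      exact (continuous_id.sub continuous_const).norm.tendsto x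
    rw [sub_self, norm_zero, Real.zero_rpow hα.ne', mul_zero] at h1
    exact h1.mono_left nhdsWithin_le_nhds

lemma measurableSet_snd_eq {d M : ℕ} (m : Fin M) :
    MeasurableSet {p : EuclideanSpace ℝ (Fin d) × Fin M | p.2 = m} :=
  measurable_snd (measurableSet_singleton m)

/-- The part of the joint law with features in `A` and label `m`, as an integral. -/
lemma measureReal_fst_mem_snd_eq {d M : ℕ} (P : Measure (EuclideanSpace ℝ (Fin d) × Fin M))
    [IsProbabilityMeasure P]
    (hPX : P.fst = (volume : Measure (EuclideanSpace ℝ (Fin d))).restrict (unitCube d))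
    (η : EuclideanSpace ℝ (Fin d) → Fin M → ℝ) (hη : IsPosterior P η)
    (hc : ContinuousOn η (unitCube d)) (m : Fin M) {A : Set (EuclideanSpace ℝ (Fin d))}
    (hA : MeasurableSet A) :
    P.real {p | p.1 ∈ A ∧ p.2 = m} = ∫ x in A, η x m ∂P.fst := by
  have hcube := measurableSet_unitCube d
  have h0 : P.fst (unitCube d)ᶜ = 0 := by
    rw [hPX, Measure.restrict_apply hcube.compl]; simp
  have hae : ∀ᵐ p ∂P, p.1 ∈ unitCube d := by
    rw [ae_iff]
    rw [Measure.fst_apply hcube.compl] at h0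
    exact h0
  have h1 : P {p | p.1 ∈ A ∧ p.2 = m} = P ((A ∩ unitCube d) ×ˢ {m}) := by
    refine measure_congr ?_
    filter_upwards [hae] with p hp
    refine propext ?_
    constructor
    · rintro ⟨h1, h2⟩; exact ⟨⟨h1, hp⟩, h2⟩
    · rintro ⟨⟨h1, _⟩, h2⟩; exact ⟨h1, h2⟩
  have h2 : P.fst.restrict A = P.fst.restrict (A ∩ unitCube d) := by
    refine Measure.restrict_congr_set ?_
    have : ∀ᵐ x ∂P.fst, x ∈ unitCube d := h0
    filter_upwards [this] with x hx
    refine propext ?_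
    exact ⟨fun h => ⟨h, hx⟩, fun h => h.1⟩
  have hsm : AEStronglyMeasurable (fun x => η x m) (P.fst.restrict (A ∩ unitCube d)) := by
    have h3 : ContinuousOn (fun x => η x m) (A ∩ unitCube d) :=
      ((continuous_apply m).comp_continuousOn hc).mono Set.inter_subset_right
    exact h3.aestronglyMeasurable (hA.inter hcube)
  rw [measureReal_def, h1, hη.disintegration m _ Set.inter_subset_right (hA.inter hcube), h2,
    integral_eq_lintegral_of_nonneg_ae _ hsm]
  filter_upwards [ae_restrict_mem (hA.inter hcube)] with x hx using hη.nonneg x hx.2 m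

lemma IsPosterior.le_one {d M : ℕ} {P : Measure (EuclideanSpace ℝ (Fin d) × Fin M)}
    {η : EuclideanSpace ℝ (Fin d) → Fin M → ℝ} (hη : IsPosterior P η)
    {x : EuclideanSpace ℝ (Fin d)} (hx : x ∈ unitCube d) (m : Fin M) : η x m ≤ 1 := by
  rw [← hη.sum_eq_one x hx]
  exact Finset.single_le_sum (f := fun m => η x m) (fun l _ => hη.nonneg x hx l)
    (Finset.mem_univ m)

/-! ### From uniform posterior estimation to the AM regret -/

lemma le_kthLargest_zero {M : ℕ} (hM : 2 ≤ M) (v : Fin M → ℝ) (m : Fin M) :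
    v m ≤ kthLargest v ⟨0, by omega⟩ := by
  obtain ⟨j, rfl⟩ := (Tuple.sort v).surjective m
  refine Tuple.monotone_sort v ?_
  rw [Fin.le_def, Fin.val_rev]
  simp only
  omega

/-- An entry that is strictly beaten cannot occupy the last place of the increasing sort, so it sits
at the second to last place or before. -/
lemma le_kthLargest_one {M : ℕ} (hM : 2 ≤ M) (v : Fin M → ℝ) {m l : Fin M} (h : v m < v l) :
    v m ≤ kthLargest v ⟨1, by omega⟩ := by
  have h0 := h.trans_le (le_kthLargest_zero hM v l)
  obtain ⟨j, rfl⟩ := (Tuple.sort v).surjective m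
  refine Tuple.monotone_sort v ?_
  have hne : j ≠ Fin.rev ⟨0, by omega⟩ := by
    rintro rfl
    exact h0.false
  have : (j : ℕ) ≠ M - 1 := by
    intro h
    apply hne
    ext
    simp [h]
  rw [Fin.le_def, Fin.val_rev]
  simp only
  omega

/-- The AM measure is the mean of the posterior over prior ratio of the predicted class. -/
lemma amMeasure_eq_integral {d M : ℕ} (P : Measure (EuclideanSpace ℝ (Fin d) × Fin M))
    [IsProbabilityMeasure P]
    (hPX : P.fst = (volume : Measure (EuclideanSpace ℝ (Fin d))).restrict (unitCube d))
    (η : EuclideanSpace ℝ (Fin d) → Fin M → ℝ) (hη : IsPosterior P η)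
    (hc : ContinuousOn η (unitCube d)) (f : EuclideanSpace ℝ (Fin d) → Fin M) (hf : Measurable f) :
    Integrable (fun x => η x (f x) / classProb P (f x)) P.fst ∧
    amMeasure P f = (1 / (M : ℝ)) * ∫ x, η x (f x) / classProb P (f x) ∂P.fst := by
  have hcube := measurableSet_unitCube d
  have hcubeae : ∀ᵐ x ∂P.fst, x ∈ unitCube d := by
    rw [hPX]; exact ae_restrict_mem hcube
  have hA : ∀ m, MeasurableSet (f ⁻¹' {m}) := fun m => hf (measurableSet_singleton m)
  have hint : ∀ m, Integrable (fun x => η x m) P.fst := by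
    intro m
    refine Integrable.of_bound (C := 1) ?_ ?_
    · rw [hPX]
      exact ((continuous_apply m).comp_continuousOn hc).aestronglyMeasurable hcube
    · filter_upwards [hcubeae] with x hx
      rw [Real.norm_eq_abs, abs_of_nonneg (hη.nonneg x hx m)]
      exact hη.le_one hx m
  have hfun : (fun x => η x (f x) / classProb P (f x)) = fun x => ∑ m,
      (f ⁻¹' {m}).indicator (fun x => η x m / classProb P m) x := by
    ext x
    rw [Finset.sum_eq_single (f x)]
    · simp
    · intro b _ hb
      rw [Set.indicator_of_notMem]
      simpa using hb.symm
    · simp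
  have hint2 : ∀ m, Integrable ((f ⁻¹' {m}).indicator (fun x => η x m / classProb P m)) P.fst :=
    fun m => ((hint m).div_const _).indicator (hA m)
  constructor
  · rw [hfun]
    exact integrable_finsetSum _ fun m _ => hint2 m
  · rw [hfun, integral_finsetSum _ fun m _ => hint2 m, amMeasure]
    congr 1
    refine Finset.sum_congr rfl fun m _ => ?_
    rw [integral_indicator (hA m), integral_div,
      ← measureReal_fst_mem_snd_eq P hPX η hη hc m (hA m), classRecall,
      measureReal_def, cond_apply (measurableSet_snd_eq m), ENNReal.toReal_mul,
      ENNReal.toReal_inv, ← measureReal_def, ← measureReal_def, classProb, div_eq_inv_mul]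
    congr 2
    ext p
    simp [and_comm]

/-- Pointwise comparison behind `amRegret_le`. -/
lemma margin_of_estimate {M : ℕ} (hM : 2 ≤ M) (v e : Fin M → ℝ) {δ : ℝ}
    (he : ∀ m, |e m - v m| ≤ δ) {f g : Fin M} (hf : ∀ m, e m ≤ e f) (hfg : v f < v g) :
    v g - v f ≤ 2 * δ ∧ |kthLargest v ⟨0, by omega⟩ - kthLargest v ⟨1, by omega⟩| ≤ 2 * δ := by
  have key : ∀ m, v m ≤ v f + 2 * δ := by
    intro m
    have h1 := (abs_le.1 (he m)).1
    have h2 := (abs_le.1 (he f)).2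
    have := hf m
    linarith
  refine ⟨by linarith [key g], ?_⟩
  have h1 := le_kthLargest_one hM v hfg
  have h0 : kthLargest v ⟨0, by omega⟩ ≤ v f + 2 * δ := key _
  have h10 : kthLargest v ⟨1, by omega⟩ ≤ kthLargest v ⟨0, by omega⟩ := le_kthLargest_zero hM v _
  rw [abs_of_nonneg (by linarith)]
  linarith

/-- The integrand of the difference to any competitor `g` equals `S * (η^w_g - η^w_f)` with `S ≤ 1 /
π₀`. It is positive only on the small-margin set, where it is at most `2 * δ / π₀`; the margin
condition bounds the mass of that set. -/
lemma amRegret_le {d M : ℕ} (hM : 2 ≤ M) (P : Measure (EuclideanSpace ℝ (Fin d) × Fin M))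
    [IsProbabilityMeasure P]
    (hPX : P.fst = (volume : Measure (EuclideanSpace ℝ (Fin d))).restrict (unitCube d))
    {π₀ : ℝ} (hπ₀ : 0 < π₀) (hP : ∀ m, π₀ ≤ classProb P m)
    (η : EuclideanSpace ℝ (Fin d) → Fin M → ℝ) (hη : IsPosterior P η)
    (hc : ContinuousOn η (unitCube d)) {β cβ : ℝ} (hcβ : 0 < cβ)
    (hMargin : MarginCondition hM P η β cβ) {δ : ℝ} (hδ : 0 < δ)
    (e : EuclideanSpace ℝ (Fin d) → Fin M → ℝ)
    (he : ∀ x ∈ unitCube d, ∀ m, |e x m - weightedPosterior P η x m| ≤ δ)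
    (f : EuclideanSpace ℝ (Fin d) → Fin M) (hf : Measurable f)
    (hfe : ∀ x ∈ unitCube d, ∀ m, e x m ≤ e x (f x)) :
    amRegret P f ≤ (2 * δ / π₀) * (cβ * (2 * δ) ^ β) := by
  have hM0 : (1 : ℝ) ≤ M := by exact_mod_cast (by omega : 1 ≤ M)
  have hcubeae : ∀ᵐ x ∂P.fst, x ∈ unitCube d := by
    rw [hPX]; exact ae_restrict_mem (measurableSet_unitCube d)
  set E₀ := {x | |kthLargest (weightedPosterior P η x) ⟨0, by omega⟩
        - kthLargest (weightedPosterior P η x) ⟨1, by omega⟩| ≤ 2 * δ} with hE₀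
  -- The measurable hull has the same mass and can be integrated over without proving `E₀`
  -- measurable.
  set E := toMeasurable P.fst E₀ with hE
  have hEm : MeasurableSet E := measurableSet_toMeasurable _ _
  have hEP : P.fst.real E ≤ cβ * (2 * δ) ^ β := by
    have h := hMargin (2 * δ) (by positivity)
    rw [measureReal_def, hE, measure_toMeasurable]
    exact ENNReal.toReal_le_of_le_ofReal (by positivity) h
  have hbd : 0 ≤ (2 * δ / π₀) * (cβ * (2 * δ) ^ β) := by positivity
  rw [amRegret, sub_le_iff_le_add]
  have : Nonempty {g : EuclideanSpace ℝ (Fin d) → Fin M // Measurable g} :=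
    ⟨⟨f, hf⟩⟩
  refine ciSup_le fun g => ?_
  obtain ⟨hgi, hg⟩ := amMeasure_eq_integral P hPX η hη hc g.1 g.2
  obtain ⟨hfi, hff⟩ := amMeasure_eq_integral P hPX η hη hc f hf
  rw [hg, hff, ← sub_le_iff_le_add, ← mul_sub, ← integral_sub hgi hfi]
  have hint : ∫ x, (η x (g.1 x) / classProb P (g.1 x) - η x (f x) / classProb P (f x)) ∂P.fst
      ≤ ∫ x, E.indicator (fun _ => 2 * δ / π₀) x ∂P.fst := by
    refine integral_mono_ae (hgi.sub hfi) ((integrable_const _).indicator hEm) ?_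
    filter_upwards [hcubeae] with x hx
    set S := ∑ l, η x l / classProb P l with hS
    have hpos : ∀ l, 0 < classProb P l := fun l => hπ₀.trans_le (hP l)
    have hS0 : 0 < S := by
      have hnn : ∀ l ∈ Finset.univ, 0 ≤ η x l / classProb P l := fun l _ =>
        div_nonneg (hη.nonneg x hx l) (hpos l).le
      refine lt_of_le_of_ne (Finset.sum_nonneg hnn) fun h => ?_
      have h0 := (Finset.sum_eq_zero_iff_of_nonneg hnn).1 h.symm
      have h1 := hη.sum_eq_one x hx
      have h2 : ∀ l, η x l = 0 := fun l => by
        have := h0 l (Finset.mem_univ l)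
        rcases div_eq_zero_iff.1 this with h | h
        · exact h
        · exact absurd h (hpos l).ne'
      simp [h2] at h1
    have hS1 : S ≤ 1 / π₀ := by
      calc S ≤ ∑ l, η x l / π₀ := Finset.sum_le_sum fun l _ =>
            div_le_div_of_nonneg_left (hη.nonneg x hx l) hπ₀ (hP l)
        _ = 1 / π₀ := by rw [← Finset.sum_div, hη.sum_eq_one x hx]
    have hv : ∀ m, η x m / classProb P m = S * weightedPosterior P η x m := by
      intro m
      rw [weightedPosterior, ← hS]
      field_simp
    simp only [hv, ← mul_sub]
    by_cases hlt : weightedPosterior P η x (f x) < weightedPosterior P η x (g.1 x)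
    · obtain ⟨h1, h2⟩ := margin_of_estimate hM _ (e x) (he x hx) (hfe x hx) hlt
      have hxE : x ∈ E := subset_toMeasurable _ _ h2
      rw [Set.indicator_of_mem hxE]
      calc S * _ ≤ (1 / π₀) * (2 * δ) := by
            apply mul_le_mul hS1 h1 (by linarith) (by positivity)
        _ = _ := by ring
    · refine le_trans (mul_nonpos_of_nonneg_of_nonpos hS0.le (by linarith)) ?_
      exact Set.indicator_nonneg (fun _ _ => by positivity) _
  rw [integral_indicator_const _ hEm, smul_eq_mul] at hint
  have h3 : P.fst.real E * (2 * δ / π₀) ≤ (2 * δ / π₀) * (cβ * (2 * δ) ^ β) := by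
    rw [mul_comm]
    exact mul_le_mul_of_nonneg_left hEP (by positivity)
  have hMi : 1 / (M : ℝ) ≤ 1 := by rw [div_le_one (by linarith)]; exact hM0
  calc _ ≤ (1 / (M : ℝ)) * ((2 * δ / π₀) * (cβ * (2 * δ) ^ β)) :=
        mul_le_mul_of_nonneg_left (hint.trans h3) (by positivity)
    _ ≤ 1 * ((2 * δ / π₀) * (cβ * (2 * δ) ^ β)) := mul_le_mul_of_nonneg_right hMi hbd
    _ = _ := one_mul _

/-! ### Masses of balls -/

/-- The volume of the Euclidean unit ball. -/
def unitBallVolume (d : ℕ) : ℝ :=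
  (volume : Measure (EuclideanSpace ℝ (Fin d))).real (Metric.ball 0 1)

lemma unitBallVolume_pos (d : ℕ) : 0 < unitBallVolume d :=
  ENNReal.toReal_pos (Metric.measure_ball_pos _ _ one_pos).ne' measure_ball_lt_top.ne

/-- The mass of the points with features in `A` and label `m`. -/
def labelMass {d M : ℕ} (P : Measure (EuclideanSpace ℝ (Fin d) × Fin M)) (m : Fin M)
    (A : Set (EuclideanSpace ℝ (Fin d))) : ℝ :=
  P.real {p | p.1 ∈ A ∧ p.2 = m}

/-- The number of sample points with features in `A` and label `m`. -/
def sampleCount {d M n : ℕ} (D : LabelledSample d M n) (m : Fin M)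
    (A : Set (EuclideanSpace ℝ (Fin d))) : ℝ :=
  ∑ i, {p : EuclideanSpace ℝ (Fin d) × Fin M | p.1 ∈ A ∧ p.2 = m}.indicator
    (fun _ => (1 : ℝ)) (D i)

section

variable {d M n : ℕ}

lemma sampleCount_mono (D : LabelledSample d M n) (m : Fin M)
    {A B : Set (EuclideanSpace ℝ (Fin d))} (h : A ⊆ B) : sampleCount D m A ≤ sampleCount D m B :=
  Finset.sum_le_sum fun _ _ => Set.indicator_le_indicator_of_subset
    (Set.ofPred_subset_ofPred.2 fun _ hp => ⟨h hp.1, hp.2⟩) (fun _ => zero_le_one) _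

lemma sampleCount_nonneg (D : LabelledSample d M n) (m : Fin M)
    (A : Set (EuclideanSpace ℝ (Fin d))) : 0 ≤ sampleCount D m A :=
  Finset.sum_nonneg fun _ _ => Set.indicator_nonneg (fun _ _ => zero_le_one) _

open Classical in
lemma sampleCount_eq_card (D : LabelledSample d M n) (m : Fin M)
    (A : Set (EuclideanSpace ℝ (Fin d))) :
    sampleCount D m A = (Finset.univ.filter fun i => (D i).1 ∈ A ∧ (D i).2 = m).card := by
  simp only [sampleCount, Set.indicator_apply, Set.mem_ofPred_eq, Finset.sum_boole]

lemma sampleCount_univ (D : LabelledSample d M n) (m : Fin M) :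
    sampleCount D m Set.univ = classCount D m := by
  classical
  rw [sampleCount_eq_card, classCount]
  simp

lemma labelMass_univ (P : Measure (EuclideanSpace ℝ (Fin d) × Fin M)) (m : Fin M) :
    labelMass P m Set.univ = classProb P m := by
  simp [labelMass, classProb]

lemma measurableSet_fst_mem_snd_eq {A : Set (EuclideanSpace ℝ (Fin d))} (hA : MeasurableSet A)
    (m : Fin M) : MeasurableSet {p : EuclideanSpace ℝ (Fin d) × Fin M | p.1 ∈ A ∧ p.2 = m} :=
  (measurable_fst hA).inter (measurableSet_snd_eq m)

lemma fst_real_le_volume {P : Measure (EuclideanSpace ℝ (Fin d) × Fin M)}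
    (hPX : P.fst = (volume : Measure (EuclideanSpace ℝ (Fin d))).restrict (unitCube d))
    {A : Set (EuclideanSpace ℝ (Fin d))} (hA : MeasurableSet A) (hfin : volume A ≠ ∞) :
    P.fst.real A ≤ (volume : Measure (EuclideanSpace ℝ (Fin d))).real A := by
  rw [hPX, measureReal_restrict_apply hA]
  exact measureReal_mono Set.inter_subset_left hfin

lemma volume_real_ball (x : EuclideanSpace ℝ (Fin d)) {r : ℝ} (hd : 1 ≤ d) (hr : 0 ≤ r) :
    (volume : Measure (EuclideanSpace ℝ (Fin d))).real (Metric.ball x r)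
      = r ^ d * unitBallVolume d := by
  have : Nonempty (Fin d) := ⟨⟨0, hd⟩⟩
  rw [measureReal_def, Measure.addHaar_ball volume x hr, ENNReal.toReal_mul,
    ENNReal.toReal_ofReal (by positivity), finrank_euclideanSpace_fin, unitBallVolume,
    measureReal_def]

lemma fst_real_ball_le {P : Measure (EuclideanSpace ℝ (Fin d) × Fin M)}
    (hPX : P.fst = (volume : Measure (EuclideanSpace ℝ (Fin d))).restrict (unitCube d))
    (hd : 1 ≤ d) (x : EuclideanSpace ℝ (Fin d)) {r : ℝ} (hr : 0 ≤ r) :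
    P.fst.real (Metric.ball x r) ≤ r ^ d * unitBallVolume d := by
  rw [← volume_real_ball x hd hr]
  exact fst_real_le_volume hPX measurableSet_ball measure_ball_lt_top.ne

lemma dist_le_of_forall_abs_sub_le {x y : EuclideanSpace ℝ (Fin d)} (hd : 1 ≤ d) {ρ : ℝ}
    (hρ : 0 ≤ ρ) (h : ∀ i, |x i - y i| ≤ ρ) : dist x y ≤ d * ρ := by
  have hd' : (1 : ℝ) ≤ d := by exact_mod_cast hd
  rw [EuclideanSpace.dist_eq, Real.sqrt_le_left (by positivity)]
  calc ∑ i, dist (x i) (y i) ^ 2 ≤ ∑ i : Fin d, ρ ^ 2 :=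
        Finset.sum_le_sum fun i _ => by
          rw [Real.dist_eq]; exact pow_le_pow_left₀ (abs_nonneg _) (h i) 2
    _ = d * ρ ^ 2 := by simp
    _ ≤ (d * ρ) ^ 2 := by
        rw [mul_pow]
        exact mul_le_mul_of_nonneg_right (by nlinarith) (sq_nonneg _)

/-- Balls centred in the cube carry a substantial mass. -/
lemma le_fst_real_ball {P : Measure (EuclideanSpace ℝ (Fin d) × Fin M)}
    (hPX : P.fst = (volume : Measure (EuclideanSpace ℝ (Fin d))).restrict (unitCube d))
    (hd : 1 ≤ d) {x : EuclideanSpace ℝ (Fin d)} (hx : x ∈ unitCube d) {r : ℝ} (hr : 0 < r)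
    (hr1 : r ≤ 1) : (r / (2 * d)) ^ d ≤ P.fst.real (Metric.ball x r) := by
  have hd' : (1 : ℝ) ≤ d := by exact_mod_cast hd
  set ρ : ℝ := r / (2 * d) with hρ
  have hρ0 : 0 < ρ := by positivity
  have hρr : d * ρ = r / 2 := by rw [hρ]; field_simp
  have hρ1 : ρ ≤ 1 / 2 := by nlinarith
  -- Corner of a box of side `ρ` that has `x` as a vertex and extends, in each coordinate, towards
  -- the farther face of the cube. As `ρ ≤ 1 / 2`, the box stays inside the cube even if `x` is on
  -- its boundary.
  set a : Fin d → ℝ := fun i => if x i ≤ 1 / 2 then x i else x i - ρ with ha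
  have hbox : WithLp.ofLp ⁻¹' (Set.Icc a (fun i => a i + ρ)) ⊆ Metric.ball x r ∩ unitCube d := by
    intro y hy
    have hy1 : ∀ i, a i ≤ y i := fun i => hy.1 i
    have hy2 : ∀ i, y i ≤ a i + ρ := fun i => hy.2 i
    constructor
    · have : dist y x ≤ d * ρ := by
        refine dist_le_of_forall_abs_sub_le hd hρ0.le fun i => ?_
        have h1 := hy1 i
        have h2 := hy2 i
        simp only [ha] at h1 h2
        rw [abs_le]
        split_ifs at h1 h2 <;> constructor <;> linarith
      rw [Metric.mem_ball]
      linarith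
    · intro i
      have h1 := hy1 i
      have h2 := hy2 i
      have h3 := (hx i).1
      have h4 := (hx i).2
      simp only [ha] at h1 h2
      split_ifs at h1 h2 with h5
      · exact ⟨by linarith, by linarith⟩
      · exact ⟨by linarith, by linarith⟩
  have hvol : (volume : Measure (EuclideanSpace ℝ (Fin d))).real
      (WithLp.ofLp ⁻¹' (Set.Icc a (fun i => a i + ρ))) = ρ ^ d := by
    rw [measureReal_def, (PiLp.volume_preserving_ofLp (Fin d)).measure_preimage
      measurableSet_Icc.nullMeasurableSet, Real.volume_Icc_pi_toReal]
    · simp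
    · intro i; simp only; linarith
  rw [hPX, measureReal_restrict_apply measurableSet_ball, ← hvol]
  exact measureReal_mono hbox
    ((measure_mono Set.inter_subset_left).trans_lt measure_ball_lt_top).ne

variable (P : Measure (EuclideanSpace ℝ (Fin d) × Fin M)) [IsProbabilityMeasure P]

lemma labelMass_le_fst (m : Fin M) {A : Set (EuclideanSpace ℝ (Fin d))} (hA : MeasurableSet A) :
    labelMass P m A ≤ P.fst.real A := by
  rw [measureReal_def, Measure.fst_apply hA, ← measureReal_def]
  exact measureReal_mono fun p hp => hp.1

lemma sum_labelMass {A : Set (EuclideanSpace ℝ (Fin d))} (hA : MeasurableSet A) :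
    ∑ m, labelMass P m A = P.fst.real A := by
  rw [measureReal_def, Measure.fst_apply hA, ← measureReal_def]
  have : Prod.fst ⁻¹' A = ⋃ m : Fin M, {p : EuclideanSpace ℝ (Fin d) × Fin M | p.1 ∈ A ∧ p.2 = m} := by
    ext p; simp
  rw [this, measureReal_iUnion_fintype]
  · rfl
  · intro m l hml
    rw [Function.onFun, Set.disjoint_left]
    rintro p ⟨_, h1⟩ ⟨_, h2⟩
    exact hml (h1.symm.trans h2)
  · exact fun m => measurableSet_fst_mem_snd_eq hA m

lemma labelMass_le_add (m : Fin M) {A B : Set (EuclideanSpace ℝ (Fin d))}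
    (hA : MeasurableSet A) (hB : MeasurableSet B) :
    labelMass P m B ≤ labelMass P m A + P.fst.real (B \ A) := by
  have : {p : EuclideanSpace ℝ (Fin d) × Fin M | p.1 ∈ B ∧ p.2 = m} ⊆
      {p | p.1 ∈ A ∧ p.2 = m} ∪ Prod.fst ⁻¹' (B \ A) := by
    intro p hp
    by_cases h : p.1 ∈ A
    · exact Or.inl ⟨h, hp.2⟩
    · exact Or.inr ⟨hp.1, h⟩
  have h2 : P.fst.real (B \ A) = P.real (Prod.fst ⁻¹' (B \ A)) := by
    rw [measureReal_def, Measure.fst_apply (hB.diff hA), ← measureReal_def]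
  rw [h2]
  exact (measureReal_mono this).trans (measureReal_union_le _ _)

lemma volume_real_closedBall (x : EuclideanSpace ℝ (Fin d)) {r : ℝ} (hr : 0 ≤ r) :
    (volume : Measure (EuclideanSpace ℝ (Fin d))).real (Metric.closedBall x r)
      = r ^ d * unitBallVolume d := by
  rw [measureReal_def, Measure.addHaar_closedBall volume x hr, ENNReal.toReal_mul,
    ENNReal.toReal_ofReal (by positivity), finrank_euclideanSpace_fin, unitBallVolume,
    measureReal_def]

lemma labelMass_closedBall_le
    (hPX : P.fst = (volume : Measure (EuclideanSpace ℝ (Fin d))).restrict (unitCube d))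
    (m : Fin M) (x : EuclideanSpace ℝ (Fin d)) {r : ℝ} (hr : 0 ≤ r) :
    labelMass P m (Metric.closedBall x r) ≤ r ^ d * unitBallVolume d := by
  rw [← volume_real_closedBall x hr]
  exact (labelMass_le_fst P m measurableSet_closedBall).trans
    (fst_real_le_volume hPX measurableSet_closedBall measure_closedBall_lt_top.ne)

lemma pow_sub_pow_le_mul {a b : ℝ} (d : ℕ) (ha : 0 ≤ a) (hab : a ≤ b) (hb : b ≤ 2) :
    b ^ d - a ^ d ≤ d * 2 ^ d * (b - a) := by
  have h := (le_abs_self _).trans (abs_pow_sub_pow_le b a d)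
  rw [abs_of_nonneg (by linarith : 0 ≤ b - a), abs_of_nonneg ha,
    abs_of_nonneg (ha.trans hab), max_eq_left hab] at h
  refine h.trans ?_
  have h1 : b ^ (d - 1) ≤ 2 ^ d := by
    calc b ^ (d - 1) ≤ 2 ^ (d - 1) := pow_le_pow_left₀ (ha.trans hab) hb _
      _ ≤ 2 ^ d := pow_le_pow_right₀ (by norm_num) (by omega)
  have h2 : 0 ≤ (b - a) * d := mul_nonneg (by linarith) (by positivity)
  calc (b - a) * d * b ^ (d - 1) ≤ (b - a) * d * 2 ^ d := mul_le_mul_of_nonneg_left h1 h2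
    _ = _ := by ring

/-- Slightly enlarging a ball changes the mass of each class only slightly. -/
lemma labelMass_closedBall_le_ball_add
    (hPX : P.fst = (volume : Measure (EuclideanSpace ℝ (Fin d))).restrict (unitCube d))
    (hd : 1 ≤ d) (m : Fin M) {x y : EuclideanSpace ℝ (Fin d)} {r s : ℝ} (hr : 0 ≤ r) (hrs : r ≤ s)
    (hs : s ≤ 2) (hsub : Metric.ball x r ⊆ Metric.closedBall y s) :
    labelMass P m (Metric.closedBall y s) ≤ labelMass P m (Metric.ball x r)
      + d * 2 ^ d * (s - r) * unitBallVolume d := by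
  refine (labelMass_le_add P m (measurableSet_ball (x := x) (ε := r)) measurableSet_closedBall).trans ?_
  have h1 := fst_real_le_volume hPX
    (measurableSet_closedBall.diff measurableSet_ball : MeasurableSet
      (Metric.closedBall y s \ Metric.ball x r))
    ((measure_mono Set.sdiff_subset).trans_lt measure_closedBall_lt_top).ne
  rw [measureReal_sdiff (μ := volume) hsub measurableSet_ball measure_closedBall_lt_top.ne,
    volume_real_closedBall y (hr.trans hrs), volume_real_ball x hd hr, ← sub_mul] at h1
  have h2 := mul_le_mul_of_nonneg_right (pow_sub_pow_le_mul d hr hrs hs) (unitBallVolume_pos d).le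
  linarith

lemma labelMass_ball_le_closedBall_add
    (hPX : P.fst = (volume : Measure (EuclideanSpace ℝ (Fin d))).restrict (unitCube d))
    (hd : 1 ≤ d) (m : Fin M) {x y : EuclideanSpace ℝ (Fin d)} {r s : ℝ} (hs : 0 ≤ s) (hrs : s ≤ r)
    (hr : r ≤ 2) (hsub : Metric.closedBall y s ⊆ Metric.ball x r) :
    labelMass P m (Metric.ball x r) ≤ labelMass P m (Metric.closedBall y s)
      + d * 2 ^ d * (r - s) * unitBallVolume d := by
  refine (labelMass_le_add P m (measurableSet_closedBall (x := y) (ε := s)) measurableSet_ball).trans ?_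
  have h1 := fst_real_le_volume hPX
    (measurableSet_ball.diff measurableSet_closedBall : MeasurableSet
      (Metric.ball x r \ Metric.closedBall y s))
    ((measure_mono Set.sdiff_subset).trans_lt measure_ball_lt_top).ne
  rw [measureReal_sdiff (μ := volume) hsub measurableSet_closedBall measure_ball_lt_top.ne,
    volume_real_closedBall y hs, volume_real_ball x hd (hs.trans hrs), ← sub_mul] at h1
  have h2 := mul_le_mul_of_nonneg_right (pow_sub_pow_le_mul d hs hrs hr) (unitBallVolume_pos d).le
  linarith

/-- Hölder continuity of the posterior, integrated over a ball. -/
lemma abs_labelMass_ball_sub_le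
    (hPX : P.fst = (volume : Measure (EuclideanSpace ℝ (Fin d))).restrict (unitCube d))
    (η : EuclideanSpace ℝ (Fin d) → Fin M → ℝ) (hη : IsPosterior P η) {α cL : ℝ} (hα : 0 < α)
    (hcL : 0 < cL) (hH : HolderPosterior η α cL) {x : EuclideanSpace ℝ (Fin d)}
    (hx : x ∈ unitCube d) (m : Fin M) {r : ℝ} :
    |labelMass P m (Metric.ball x r) - η x m * P.fst.real (Metric.ball x r)|
      ≤ cL * r ^ α * P.fst.real (Metric.ball x r) := by
  have hc := hH.continuousOn hα
  rw [labelMass, measureReal_fst_mem_snd_eq P hPX η hη hc m measurableSet_ball]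
  have hcubeae : ∀ᵐ y ∂(P.fst.restrict (Metric.ball x r)), y ∈ unitCube d := by
    refine ae_restrict_of_ae ?_
    rw [hPX]; exact ae_restrict_mem (measurableSet_unitCube d)
  have hint : IntegrableOn (fun y => η y m) (Metric.ball x r) P.fst := by
    refine Integrable.of_bound (C := 1) ?_ ?_
    · refine AEStronglyMeasurable.restrict ?_
      rw [hPX]
      exact ((continuous_apply m).comp_continuousOn hc).aestronglyMeasurable
        (measurableSet_unitCube d)
    · filter_upwards [hcubeae] with y hy
      rw [Real.norm_eq_abs, abs_of_nonneg (hη.nonneg y hy m)]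
      exact hη.le_one hy m
  have hconst : η x m * P.fst.real (Metric.ball x r) = ∫ y in Metric.ball x r, η x m ∂P.fst := by
    rw [setIntegral_const, smul_eq_mul, mul_comm]
  rw [hconst, ← integral_sub hint (integrable_const _), ← Real.norm_eq_abs]
  have := norm_integral_le_of_norm_le_const (μ := P.fst.restrict (Metric.ball x r))
    (f := fun y => η y m - η x m) (C := cL * r ^ α) (by
      filter_upwards [hcubeae, ae_restrict_mem measurableSet_ball] with y hy hyb
      have h1 := hH x hx y hy
      have h2 : ‖η y m - η x m‖ ≤ ‖η y - η x‖ := norm_le_pi_norm (η y - η x) m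
      refine h2.trans (h1.trans (mul_le_mul_of_nonneg_left ?_ hcL.le))
      refine Real.rpow_le_rpow (norm_nonneg _) ?_ hα.le
      rw [← dist_eq_norm]
      exact (Metric.mem_ball.1 hyb).le)
  simpa using this

end

/-! ### Uniform deviations over balls -/

/-- Points of the grid of mesh `1 / n` in the unit cube. -/
def gridPoint {d n : ℕ} (g : Fin d → Fin (n + 1)) : EuclideanSpace ℝ (Fin d) :=
  WithLp.toLp 2 fun i => (g i : ℝ) / n

section

variable {d M n : ℕ}

lemma exists_gridPoint_dist_le (hd : 1 ≤ d) (hn : 0 < n) {x : EuclideanSpace ℝ (Fin d)}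
    (hx : x ∈ unitCube d) : ∃ g : Fin d → Fin (n + 1), dist x (gridPoint g) ≤ d / n := by
  have hn' : (0 : ℝ) < n := by exact_mod_cast hn
  refine ⟨fun i => ⟨⌊n * x i⌋₊, ?_⟩, ?_⟩
  · rw [Nat.lt_succ_iff]
    refine Nat.floor_le_of_le ?_
    have := (hx i).2
    nlinarith
  · have := dist_le_of_forall_abs_sub_le (x := x)
      (y := gridPoint fun i => (⟨⌊n * x i⌋₊, by
        rw [Nat.lt_succ_iff]
        refine Nat.floor_le_of_le ?_
        have := (hx i).2
        nlinarith⟩ : Fin (n + 1))) hd (ρ := 1 / n) (by positivity) (fun i => by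
      have h0 : 0 ≤ n * x i := mul_nonneg hn'.le (hx i).1
      have h1 := Nat.floor_le h0
      have h2 := Nat.lt_floor_add_one (n * x i)
      simp only [gridPoint]
      have h3 : x i - (⌊n * x i⌋₊ : ℝ) / n = (n * x i - ⌊n * x i⌋₊) / n := by
        field_simp
      rw [h3, abs_of_nonneg (div_nonneg (by linarith) hn'.le)]
      exact div_le_div_of_nonneg_right (by linarith) hn'.le)
    rwa [mul_one_div] at this

/-- The discretization error in passing from grid balls to all balls. -/
def gridError (d : ℕ) : ℝ := d * 2 ^ d * (2 * d + 2) * unitBallVolume d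

lemma gridError_nonneg (d : ℕ) : 0 ≤ gridError d := by
  have := unitBallVolume_pos d
  unfold gridError
  positivity

/-- A shell of width of order `1 / n` has volume of order `1 / n`, so the expected number of sample
points in it is bounded independently of `n`. -/
lemma annulus_le_gridError {δ : ℝ} (hn : 0 < n) (hδ : δ ≤ (d + 1) / n) :
    n * (d * 2 ^ d * δ * unitBallVolume d) ≤ gridError d := by
  have hn' : (0 : ℝ) < n := by exact_mod_cast hn
  have hω := unitBallVolume_pos d
  rw [le_div_iff₀ hn'] at hδ
  calc n * (d * 2 ^ d * δ * unitBallVolume d) = d * 2 ^ d * (δ * n) * unitBallVolume d := by ring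
    _ ≤ d * 2 ^ d * (2 * d + 2) * unitBallVolume d := by
        gcongr
        have : (0 : ℝ) ≤ d := by positivity
        linarith
    _ = _ := rfl

/-- Control of the counts in grid balls yields control of the counts in all balls. -/
lemma sampleCount_ball_of_grid (P : Measure (EuclideanSpace ℝ (Fin d) × Fin M))
    [IsProbabilityMeasure P]
    (hPX : P.fst = (volume : Measure (EuclideanSpace ℝ (Fin d))).restrict (unitCube d))
    (hd : 1 ≤ d) (hn : 2 * d + 2 ≤ n) (D : LabelledSample d M n) {h t : ℝ} (hh1 : h ≤ 1)
    (ht : 0 ≤ t)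
    (hgrid : ∀ (g : Fin d → Fin (n + 1)) (j : Fin (2 * n + 1)) (m : Fin M),
      (j : ℝ) / n ≤ h + (2 * d + 2) / n →
      |sampleCount D m (Metric.closedBall (gridPoint g) (j / n))
        - n * labelMass P m (Metric.closedBall (gridPoint g) (j / n))| ≤ t)
    {x : EuclideanSpace ℝ (Fin d)} (hx : x ∈ unitCube d) {r : ℝ} (hr : 0 ≤ r) (hrh : r ≤ h)
    (m : Fin M) :
    sampleCount D m (Metric.closedBall x r)
        ≤ n * labelMass P m (Metric.ball x r) + (t + gridError d) ∧
      n * labelMass P m (Metric.ball x r) - (t + gridError d)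
        ≤ sampleCount D m (Metric.ball x r) := by
  have hn0 : 0 < n := by omega
  have hn' : (0 : ℝ) < n := by exact_mod_cast hn0
  have hd' : (1 : ℝ) ≤ d := by exact_mod_cast hd
  have hdn : (2 * d + 2 : ℝ) / n ≤ 1 := by rw [div_le_one hn']; exact_mod_cast hn
  obtain ⟨g, hg⟩ := exists_gridPoint_dist_le hd hn0 hx
  have hnr0 : 0 ≤ n * r := by positivity
  have hc1 := Nat.le_ceil (n * r)
  have hc2 := Nat.ceil_lt_add_one hnr0
  have hcn : ⌈n * r⌉₊ ≤ n := Nat.ceil_le.2 (by nlinarith)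
  have hsplit : (2 * d + 2 : ℝ) / n = d / n + (d + 1) / n + 1 / n := by
    rw [← add_div, ← add_div]; congr 1; ring
  have hn1 : 0 ≤ 1 / (n : ℝ) := by positivity
  have hdn0 : 0 ≤ (d : ℝ) / n := by positivity
  have hdn1 : ((d : ℝ) + 1) / n = d / n + 1 / n := add_div _ _ _
  constructor
  -- Outer approximation: a grid centre is at distance at most `d / n` from `x`, so adding `d` steps
  -- to the rounded radius encloses the ball around `x`.
  · set j : ℕ := ⌈n * r⌉₊ + d with hj
    have hjr : r + d / n ≤ (j : ℝ) / n := by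
      rw [hj, Nat.cast_add, add_div]
      have : r ≤ (⌈n * r⌉₊ : ℝ) / n := by rw [le_div_iff₀ hn']; linarith
      linarith
    have hjr2 : (j : ℝ) / n ≤ r + (d + 1) / n := by
      rw [hj, Nat.cast_add, div_le_iff₀ hn', add_mul, div_mul_cancel₀ _ hn'.ne']
      linarith
    have hsub : Metric.closedBall x r ⊆ Metric.closedBall (gridPoint g) (j / n) :=
      Metric.closedBall_subset_closedBall' (by linarith)
    have h1 := hgrid g ⟨j, by omega⟩ m (by simp only; linarith)
    simp only at h1
    have h2 := labelMass_closedBall_le_ball_add P hPX hd m hr (by linarith) (by linarith)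
      (Metric.ball_subset_closedBall.trans hsub)
    have h3 := annulus_le_gridError (d := d) hn0 (δ := (j : ℝ) / n - r) (by linarith)
    have h4 := sampleCount_mono D m hsub
    have h5 := mul_le_mul_of_nonneg_left h2 hn'.le
    rw [mul_add] at h5
    have h6 := (abs_le.1 h1).2
    linarith
  -- Inner approximation: `d` steps are lost for the shift of the centre and one for rounding up. If
  -- the radius is too small for this, the ball itself has mass of order `1 / n` and the lower bound
  -- is trivial.
  · rcases Nat.lt_or_ge d ⌈n * r⌉₊ with hlt | hge
    · set j : ℕ := ⌈n * r⌉₊ - (d + 1) with hj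
      have hj' : (j : ℝ) = ⌈n * r⌉₊ - (d + 1) := by
        rw [hj, Nat.cast_sub (by omega)]; push_cast; ring
      have hjr : (j : ℝ) / n + d / n < r := by
        rw [← add_div, div_lt_iff₀ hn', hj']
        linarith
      have hjr2 : r - (d + 1) / n ≤ (j : ℝ) / n := by
        rw [le_div_iff₀ hn', sub_mul, div_mul_cancel₀ _ hn'.ne', hj']
        linarith
      have hsub : Metric.closedBall (gridPoint g) (j / n) ⊆ Metric.ball x r :=
        Metric.closedBall_subset_ball' (by rw [dist_comm]; linarith)
      have h1 := hgrid g ⟨j, by omega⟩ m (by simp only; linarith)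
      simp only at h1
      have h2 := labelMass_ball_le_closedBall_add P hPX hd m (by positivity) (by linarith)
        (by linarith) hsub
      have h3 := annulus_le_gridError (d := d) hn0 (δ := r - (j : ℝ) / n) (by linarith)
      have h4 := sampleCount_mono D m hsub
      have h5 := mul_le_mul_of_nonneg_left h2 hn'.le
      rw [mul_add] at h5
      have h6 := (abs_le.1 h1).1
      linarith
    · have hrd : r ≤ (d + 1) / n := by
        rw [le_div_iff₀ hn']
        have : (⌈n * r⌉₊ : ℝ) ≤ d := by exact_mod_cast hge
        linarith
      have h1 : labelMass P m (Metric.ball x r) ≤ d * 2 ^ d * r * unitBallVolume d := by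
        refine (labelMass_le_fst P m measurableSet_ball).trans
          ((fst_real_ball_le hPX hd x hr).trans ?_)
        have := pow_sub_pow_le_mul d le_rfl hr (by linarith)
        rw [zero_pow (by omega), sub_zero, sub_zero] at this
        exact mul_le_mul_of_nonneg_right this (unitBallVolume_pos d).le
      have h2 := annulus_le_gridError (d := d) hn0 hrd
      have h3 := sampleCount_nonneg D m (Metric.ball x r)
      have h4 := mul_le_mul_of_nonneg_left h1 hn'.le
      linarith

/-- With high probability the counts in all small grid balls are close to their means. -/
lemma measureReal_grid_deviation_le (P : Measure (EuclideanSpace ℝ (Fin d) × Fin M))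
    [IsProbabilityMeasure P]
    (hPX : P.fst = (volume : Measure (EuclideanSpace ℝ (Fin d))).restrict (unitCube d))
    (hn : 0 < n) {h' q t : ℝ} (hq : h' ^ d * unitBallVolume d ≤ q) (hq0 : 0 < q)
    (ht : 0 ≤ t) (htq : t ≤ 2 * (n * q)) :
    (Measure.pi fun _ : Fin n => P).real
      {D | ∃ (g : Fin d → Fin (n + 1)) (j : Fin (2 * n + 1)) (m : Fin M), (j : ℝ) / n ≤ h' ∧
        t ≤ |sampleCount D m (Metric.closedBall (gridPoint g) (j / n))
          - n * labelMass P m (Metric.closedBall (gridPoint g) (j / n))|}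
      ≤ (n + 1) ^ d * (2 * n + 1) * M * (2 * Real.exp (-(t ^ 2 / (4 * (n * q))))) := by
  set ν := Measure.pi fun _ : Fin n => P
  set S : (Fin d → Fin (n + 1)) × Fin (2 * n + 1) × Fin M → Set (LabelledSample d M n) := fun a =>
    {D | (a.2.1 : ℝ) / n ≤ h' ∧
        t ≤ |sampleCount D a.2.2 (Metric.closedBall (gridPoint a.1) (a.2.1 / n))
          - n * labelMass P a.2.2 (Metric.closedBall (gridPoint a.1) (a.2.1 / n))|} with hS
  have hsub : {D | ∃ (g : Fin d → Fin (n + 1)) (j : Fin (2 * n + 1)) (m : Fin M),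
      (j : ℝ) / n ≤ h' ∧ t ≤ |sampleCount D m (Metric.closedBall (gridPoint g) (j / n))
          - n * labelMass P m (Metric.closedBall (gridPoint g) (j / n))|} ⊆ ⋃ a, S a := by
    rintro D ⟨g, j, m, hD⟩
    exact Set.mem_iUnion.2 ⟨(g, j, m), hD⟩
  refine (measureReal_mono hsub).trans ((measureReal_iUnion_fintype_le _).trans ?_)
  have hbd : ∀ a, ν.real (S a) ≤ 2 * Real.exp (-(t ^ 2 / (4 * (n * q)))) := by
    intro a
    by_cases ha : (a.2.1 : ℝ) / n ≤ h'
    · have hm := labelMass_closedBall_le P hPX a.2.2 (gridPoint a.1)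
        (r := (a.2.1 : ℝ) / n) (by positivity)
      have hle : labelMass P a.2.2 (Metric.closedBall (gridPoint a.1) (a.2.1 / n)) ≤ q := by
        refine hm.trans (le_trans ?_ hq)
        exact mul_le_mul_of_nonneg_right (pow_le_pow_left₀ (by positivity) ha _)
          (unitBallVolume_pos d).le
      have := measureReal_pi_count_le P n
        (measurableSet_fst_mem_snd_eq (measurableSet_closedBall (x := gridPoint a.1)
          (ε := (a.2.1 : ℝ) / n)) a.2.2) hle hq0 hn ht htq
      refine (measureReal_mono ?_).trans this
      rintro D ⟨_, hD⟩
      exact hD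
    · have : S a = ∅ := by
        ext D
        simp [hS, ha]
      rw [this, measureReal_empty]
      positivity
  refine (Finset.sum_le_sum fun a _ => hbd a).trans (le_of_eq ?_)
  simp only [Finset.sum_const, Finset.card_univ, Fintype.card_prod, Fintype.card_fin,
    Fintype.card_fun, nsmul_eq_mul]
  push_cast
  ring

/-- With high probability the class frequencies are close to the class probabilities. -/
lemma measureReal_classCount_deviation_le (P : Measure (EuclideanSpace ℝ (Fin d) × Fin M))
    [IsProbabilityMeasure P] (hn : 0 < n) {t : ℝ} (ht : 0 ≤ t) (htn : t ≤ 2 * n) :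
    (Measure.pi fun _ : Fin n => P).real
      {D | ∃ m : Fin M, t ≤ |(classCount D m : ℝ) - n * classProb P m|}
      ≤ M * (2 * Real.exp (-(t ^ 2 / (4 * n)))) := by
  have hsub : {D : LabelledSample d M n | ∃ m : Fin M,
      t ≤ |(classCount D m : ℝ) - n * classProb P m|} ⊆
      ⋃ m : Fin M, {D | t ≤ |(classCount D m : ℝ) - n * classProb P m|} := by
    rintro D ⟨m, hD⟩
    exact Set.mem_iUnion.2 ⟨m, hD⟩
  refine (measureReal_mono hsub).trans ((measureReal_iUnion_fintype_le _).trans ?_)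
  have hbd : ∀ m : Fin M, (Measure.pi fun _ : Fin n => P).real
      {D | t ≤ |(classCount D m : ℝ) - n * classProb P m|} ≤
      2 * Real.exp (-(t ^ 2 / (4 * n))) := by
    intro m
    have := measureReal_pi_count_le P n (measurableSet_fst_mem_snd_eq MeasurableSet.univ m)
      (q := 1) measureReal_le_one one_pos hn ht (by linarith)
    rw [mul_one] at this
    refine (measureReal_mono ?_).trans this
    intro D hD
    rw [Set.mem_ofPred_eq, ← sampleCount_univ, ← labelMass_univ] at hD
    exact hD
  refine (Finset.sum_le_sum fun a _ => hbd a).trans (le_of_eq ?_)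
  simp

end

/-! ### Concentration of the bags given the sample -/

section

variable {d M n : ℕ}

instance isProbabilityMeasure_bagLaw (D : LabelledSample d M n) (s : ℝ) (B : ℕ) :
    IsProbabilityMeasure (bagLaw D s B) := by
  unfold bagLaw; infer_instance

open Classical in
/-- The indicator that the `i`-th point belongs to class `m` and is considered before `k` points
have been accepted. -/
def activeIndicator (D : LabelledSample d M n) (k : ℕ) (x : EuclideanSpace ℝ (Fin d)) (m : Fin M)
    (i : Fin n) (z : Fin n → Bool) : ℝ :=
  if nnRank D z x i < k ∧ (D i).2 = m then 1 else 0

/-- The centred number of accepted points of class `m` among the `k` nearest neighbours of `x`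
in a bag, restricted to the first `T` points of the sample. -/
def bagDeviation (D : LabelledSample d M n) (s : ℝ) (k T : ℕ) (x : EuclideanSpace ℝ (Fin d))
    (m : Fin M) (z : Fin n → Bool) : ℝ :=
  ∑ i ∈ firstPoints D x T, (boolReal (z i) - acceptProb D s i) * activeIndicator D k x m i z

lemma abs_boolReal_sub_le {b : Bool} {p : ℝ} (h0 : 0 ≤ p) (h1 : p ≤ 1) :
    |boolReal b - p| ≤ 1 := by
  cases b <;> simp [boolReal, abs_le] <;> constructor <;> linarith

lemma abs_activeIndicator_le (D : LabelledSample d M n) (k : ℕ) (x : EuclideanSpace ℝ (Fin d))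
    (m : Fin M) (i : Fin n) (z : Fin n → Bool) : |activeIndicator D k x m i z| ≤ 1 := by
  unfold activeIndicator
  split_ifs <;> simp

lemma abs_sum_mul_le {ι : Type*} (W : Finset ι) (u ξ : ι → ℝ) (hu : ∀ i, |u i| ≤ 1)
    (hξ : ∀ i, |ξ i| ≤ 1) : |∑ i ∈ W, u i * ξ i| ≤ W.card := by
  refine (Finset.abs_sum_le_sum_abs _ _).trans ?_
  refine (Finset.sum_le_sum (g := fun _ => (1 : ℝ)) fun i _ => ?_).trans (by simp)
  rw [abs_mul]
  exact mul_le_one₀ (hu i) (abs_nonneg _) (hξ i)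

/-- The exponential moment bound for one bag. -/
lemma integral_bag_exp_le (D : LabelledSample d M n) {s : ℝ}
    (ha : ∀ i, acceptProb D s i ∈ Set.Icc (0 : ℝ) 1) (x : EuclideanSpace ℝ (Fin d))
    (W : Finset (Fin n)) (ξ : Fin n → (Fin n → Bool) → ℝ) (hξ1 : ∀ i z, |ξ i z| ≤ 1)
    (hξ : ∀ i j z b, nnRank D (fun _ => true) x i ≤ nnRank D (fun _ => true) x j →
      ξ i (Function.update z j b) = ξ i z)
    {θ : ℝ} (hθ : |θ| ≤ 1) :
    ∫ z, Real.exp (θ * ∑ i ∈ W, (boolReal (z i) - acceptProb D s i) * ξ i z)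
        ∂(Measure.pi fun i => bernoulliMeasure true false
          (Set.projIcc (0 : ℝ) 1 zero_le_one (acceptProb D s i)))
      ≤ Real.exp (θ ^ 2 * ∑ i ∈ W, acceptProb D s i) := by
  have := integral_predictable_exp_le
    (fun i => Set.projIcc (0 : ℝ) 1 zero_le_one (acceptProb D s i))
    (nnRank D (fun _ => true) x) ξ hξ1 hξ hθ W
    ((nnRank_injOn D (fun _ => true) x).mono (fun _ _ => rfl))
  have hp : ∀ i, ((Set.projIcc (0 : ℝ) 1 zero_le_one (acceptProb D s i) : unitInterval) : ℝ)
      = acceptProb D s i := fun i => by rw [Set.projIcc_of_mem _ (ha i)]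
  simpa only [hp] using this

/-- A given bag accepts enough of the first `T` points. -/
lemma bagLaw_real_card_lt_le (D : LabelledSample d M n) {s : ℝ} {B k : ℕ}
    (ha : ∀ i, acceptProb D s i ∈ Set.Icc (0 : ℝ) 1) (W : Finset (Fin n)) {a : ℝ} (ha0 : 0 < a)
    (haW : a ≤ ∑ i ∈ W, acceptProb D s i) (hk : (k : ℝ) ≤ a / 2) (b : Fin B) :
    (bagLaw D s B).real {z | (W.filter fun i => z b i = true).card < k}
      ≤ 2 * Real.exp (-(a / 16)) := by
  set A := ∑ i ∈ W, acceptProb D s i with hA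
  have hA0 : 0 < A := ha0.trans_le haW
  have h := measureReal_pi_abs_sum_ge_le
    (fun _ : Fin B => Measure.pi fun i => bernoulliMeasure true false
          (Set.projIcc (0 : ℝ) 1 zero_le_one (acceptProb D s i)))
    -- Only bag `b` contributes, so the bound for sums over all bags applies to a single one. With
    -- constant coefficients any ordering will do, whence the arbitrary point `0` below.
    (fun c z => if c = b then ∑ i ∈ W, (boolReal (z i) - acceptProb D s i) * 1 else 0)
    (fun _ => measurable_of_finite _) (R := W.card)
    (by
      intro c z
      split_ifs
      · exact abs_sum_mul_le W _ _ (fun i => abs_boolReal_sub_le (ha i).1 (ha i).2) (by simp)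
      · simp)
    (fun c => if c = b then A else 0)
    (by
      intro c θ hθ
      split_ifs
      · exact integral_bag_exp_le D ha 0 W (fun _ _ => 1) (by simp) (by simp) hθ
      · simp)
    (V := A) (t := A / 2) (by simp) hA0 (by positivity) (by linarith)
  have he : Real.exp (-((A / 2) ^ 2 / (4 * A))) ≤ Real.exp (-(a / 16)) := by
    rw [Real.exp_le_exp, neg_le_neg_iff]
    have : (A / 2) ^ 2 / (4 * A) = A / 16 := by field_simp; ring
    rw [this]
    linarith
  refine (measureReal_mono ?_).trans (h.trans (by linarith))
  intro z hz
  have hz' : ((W.filter fun i => z b i = true).card : ℝ) < k := by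
    exact_mod_cast (show (W.filter fun i => z b i = true).card < k from hz)
  rw [Set.mem_ofPred_eq]
  simp only [mul_one, Finset.sum_ite_eq', Finset.mem_univ, if_true]
  have hsum : ∑ i ∈ W, (boolReal (z b i) - acceptProb D s i)
      = ((W.filter fun i => z b i = true).card : ℝ) - A := by
    rw [Finset.sum_sub_distrib]
    congr 1
    simp [boolReal]
  rw [hsum, abs_sub_comm]
  refine le_trans ?_ (le_abs_self _)
  linarith

/-- The bag deviations, summed over all bags, are small. -/
lemma bagLaw_real_deviation_le (D : LabelledSample d M n) {s : ℝ} {B : ℕ} (hB : 0 < B) (k T : ℕ)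
    (ha : ∀ i, acceptProb D s i ∈ Set.Icc (0 : ℝ) 1) (x : EuclideanSpace ℝ (Fin d)) (m : Fin M)
    {A t : ℝ} (hA0 : 0 < A) (hA : ∑ i ∈ firstPoints D x T, acceptProb D s i ≤ A)
    (ht : 0 ≤ t) (htA : t ≤ 2 * (B * A)) :
    (bagLaw D s B).real {z | t ≤ |∑ b, bagDeviation D s k T x m (z b)|}
      ≤ 2 * Real.exp (-(t ^ 2 / (4 * (B * A)))) := by
  have hB' : (0 : ℝ) < B := by exact_mod_cast hB
  exact measureReal_pi_abs_sum_ge_le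
    (fun _ : Fin B => Measure.pi fun i => bernoulliMeasure true false
          (Set.projIcc (0 : ℝ) 1 zero_le_one (acceptProb D s i)))
    (fun _ z => bagDeviation D s k T x m z)
    (fun _ => measurable_of_finite _) (R := (firstPoints D x T).card)
    (fun c z => abs_sum_mul_le _ _ _ (fun i => abs_boolReal_sub_le (ha i).1 (ha i).2)
      (fun i => abs_activeIndicator_le D k x m i z))
    (fun c => A)
    (by
      intro c θ hθ
      refine (integral_bag_exp_le D ha x (firstPoints D x T)
        (fun i z => activeIndicator D k x m i z)
        (fun i z => abs_activeIndicator_le D k x m i z) ?_ hθ).trans ?_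
      · intro i j z b hij
        simp only [activeIndicator, nnRank_update D z x b hij]
      · exact Real.exp_le_exp.2 (mul_le_mul_of_nonneg_left hA (sq_nonneg _)))
    (V := B * A) (by simp) (by positivity) ht htA

/-- Given the sample, with high probability all bags behave well simultaneously at all points. -/
lemma bagLaw_real_bad_le (D : LabelledSample d M n) {s : ℝ} {B : ℕ} (hB : 0 < B) (k T : ℕ)
    (ha : ∀ i, acceptProb D s i ∈ Set.Icc (0 : ℝ) 1) {a A t : ℝ} (ha0 : 0 < a) (hA0 : 0 < A)
    (haW : ∀ x, a ≤ ∑ i ∈ firstPoints D x T, acceptProb D s i) (hk : (k : ℝ) ≤ a / 2)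
    (hAW : ∀ x, ∑ i ∈ firstPoints D x T, acceptProb D s i ≤ A)
    (ht : 0 ≤ t) (htA : t ≤ 2 * (B * A)) :
    (bagLaw D s B).real {z | ∃ x,
        (∃ b, ((firstPoints D x T).filter fun i => z b i = true).card < k) ∨
        ∃ m, t ≤ |∑ b, bagDeviation D s k T x m (z b)|}
      ≤ (n ^ 2 + 1) ^ (d + 1) * (B * (2 * Real.exp (-(a / 16)))
        + M * (2 * Real.exp (-(t ^ 2 / (4 * (B * A)))))) := by
  obtain ⟨X₀, hcard, hX₀⟩ := exists_representatives fun i => (D i).1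
  have hsub : {z : Fin B → Fin n → Bool | ∃ x,
        (∃ b, ((firstPoints D x T).filter fun i => z b i = true).card < k) ∨
        ∃ m, t ≤ |∑ b, bagDeviation D s k T x m (z b)|} ⊆
      ⋃ x ∈ X₀, ((⋃ b, {z | ((firstPoints D x T).filter fun i => z b i = true).card < k}) ∪
        ⋃ m, {z | t ≤ |∑ b, bagDeviation D s k T x m (z b)|}) := by
    rintro z ⟨x, hz⟩
    obtain ⟨x₀, hx₀, hx⟩ := hX₀ x
    have hr : ∀ z i, nnRank D z x i = nnRank D z x₀ i := nnRank_congr hx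
    have hW : firstPoints D x T = firstPoints D x₀ T := by simp only [firstPoints, hr]
    have hdev : ∀ m z, bagDeviation D s k T x m z = bagDeviation D s k T x₀ m z := by
      intro m z
      simp only [bagDeviation, activeIndicator, hW, hr]
    simp only [hW, hdev] at hz
    simp only [Set.mem_iUnion, Set.mem_union]
    exact ⟨x₀, hx₀, hz⟩
  refine (measureReal_mono hsub (measure_ne_top _ _)).trans ((measureReal_biUnion_finset_le _ _).trans ?_)
  have hbd : ∀ x ∈ X₀, (bagLaw D s B).real
      ((⋃ b, {z | ((firstPoints D x T).filter fun i => z b i = true).card < k}) ∪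
        ⋃ m, {z | t ≤ |∑ b, bagDeviation D s k T x m (z b)|})
      ≤ B * (2 * Real.exp (-(a / 16))) + M * (2 * Real.exp (-(t ^ 2 / (4 * (B * A))))) := by
    intro x _
    refine (measureReal_union_le _ _).trans (add_le_add ?_ ?_)
    · refine (measureReal_iUnion_fintype_le _).trans ?_
      refine (Finset.sum_le_sum fun b _ =>
        bagLaw_real_card_lt_le D ha _ ha0 (haW x) hk b).trans (by simp)
    · refine (measureReal_iUnion_fintype_le _).trans ?_
      refine (Finset.sum_le_sum fun m _ =>
        bagLaw_real_deviation_le D hB k T ha x m hA0 (hAW x) ht htA).trans (by simp)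
  refine (Finset.sum_le_sum hbd).trans ?_
  rw [Finset.sum_const, nsmul_eq_mul]
  refine mul_le_mul_of_nonneg_right ?_ (by positivity)
  exact_mod_cast hcard

end

/-! ### The estimation error on the good event -/

/-- The scale `G` is unknown, but summing the approximations and using `∑ m, u m = k` forces `G * ∑
m, g m` to be within `M * Δ` of `k`. Normalization thus removes `G` at the cost of a factor `1 + M`.
-/
lemma abs_normalize_sub_le {M : ℕ} (u g : Fin M → ℝ) (hg : ∀ m, 0 ≤ g m) (hg0 : 0 < ∑ m, g m)
    {G Δ k : ℝ} (hk : 0 < k) (hu : ∀ m, |u m - G * g m| ≤ Δ) (hsum : ∑ m, u m = k) (m : Fin M) :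
    |u m / k - g m / ∑ l, g l| ≤ (1 + M) * Δ / k := by
  set S := ∑ l, g l with hS
  have h1 : |k - G * S| ≤ M * Δ := by
    have : k - G * S = ∑ l, (u l - G * g l) := by
      rw [Finset.sum_sub_distrib, hsum, ← Finset.mul_sum]
    rw [this]
    refine (Finset.abs_sum_le_sum_abs _ _).trans ((Finset.sum_le_sum fun l _ => hu l).trans ?_)
    simp
  have hq0 : 0 ≤ g m / S := div_nonneg (hg m) hg0.le
  have hq1 : g m / S ≤ 1 := by
    rw [div_le_one hg0]
    exact Finset.single_le_sum (f := g) (fun l _ => hg l) (Finset.mem_univ m)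
  have h2 : u m / k - g m / S = ((u m - G * g m) - (k - G * S) * (g m / S)) / k := by
    field_simp
    ring
  rw [h2, abs_div, abs_of_pos hk]
  refine div_le_div_of_nonneg_right ?_ hk.le
  refine (abs_sub _ _).trans ?_
  rw [abs_mul, abs_of_nonneg hq0]
  have h3 : |k - G * S| * (g m / S) ≤ M * Δ := by
    have := mul_le_mul h1 hq1 hq0 ((abs_nonneg _).trans h1)
    linarith
  linarith [hu m]

section

variable {d M n : ℕ}

/-- Concentration needs the fixed window of `T` points, to have a deterministic variance bound. Once
the window contains `k` accepted points, nothing outside it is visited and the restriction can be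
dropped. -/
lemma sum_firstPoints_mul_activeIndicator (D : LabelledSample d M n) {k T : ℕ}
    {x : EuclideanSpace ℝ (Fin d)} {z : Fin n → Bool}
    (hk : k ≤ ((firstPoints D x T).filter fun i => z i = true).card) (m : Fin M)
    (u : Fin n → ℝ) :
    ∑ i ∈ firstPoints D x T, u i * activeIndicator D k x m i z
      = ∑ i, u i * activeIndicator D k x m i z := by
  refine Finset.sum_subset (Finset.subset_univ _) fun i _ hi => ?_
  rw [activeIndicator, if_neg, mul_zero]
  exact fun h => hi (mem_firstPoints_of_nnRank_lt D hk h.1)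

lemma sum_boolReal_mul_activeIndicator (D : LabelledSample d M n) (k : ℕ)
    (x : EuclideanSpace ℝ (Fin d)) (z : Fin n → Bool) (m : Fin M) :
    ∑ i, boolReal (z i) * activeIndicator D k x m i z
      = ({i : Fin n | z i = true ∧ nnRank D z x i < k ∧ (D i).2 = m}.ncard : ℝ) := by
  classical
  rw [Set.ncard_eq_toFinset_card']
  simp only [boolReal, activeIndicator, ← ite_and, mul_ite, mul_one, mul_zero]
  simp only [Finset.sum_boole]
  congr 2
  ext i
  simp [and_comm]

lemma sum_ncard_nearest (D : LabelledSample d M n) {k : ℕ} (x : EuclideanSpace ℝ (Fin d))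
    (z : Fin n → Bool) (hk : k ≤ (Finset.univ.filter fun i => z i = true).card) :
    ∑ m, ({i : Fin n | z i = true ∧ nnRank D z x i < k ∧ (D i).2 = m}.ncard : ℝ) = k := by
  classical
  have h := card_filter_nnRank_lt D z x hk
  rw [Finset.card_eq_sum_card_fiberwise (f := fun i => (D i).2) (t := Finset.univ)
    (fun _ _ => by simp)] at h
  rw [← Nat.cast_sum]
  norm_cast
  refine (Finset.sum_congr rfl fun m _ => ?_).trans h
  rw [Set.ncard_eq_toFinset_card']
  congr 1
  ext i
  simp [and_assoc]

/-- The acceptance probability is constant on each class. This is where the weights `1 / n_(m)`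
enter and turn `η` into the weighted posterior. -/
lemma sum_acceptProb_mul_activeIndicator (D : LabelledSample d M n) (s : ℝ) (k : ℕ)
    (x : EuclideanSpace ℝ (Fin d)) (z : Fin n → Bool) (m : Fin M) :
    ∑ i, acceptProb D s i * activeIndicator D k x m i z
      = s / (M * classCount D m) * ∑ i, activeIndicator D k x m i z := by
  rw [Finset.mul_sum]
  refine Finset.sum_congr rfl fun i _ => ?_
  by_cases h : nnRank D z x i < k ∧ (D i).2 = m
  · rw [acceptProb, h.2]
  · rw [activeIndicator, if_neg h, mul_zero, mul_zero]

/-- The number of class `m` points visited in a bag is close to `n η_m(x)` times the mass of a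
ball. -/
lemma exists_mass_of_bag (P : Measure (EuclideanSpace ℝ (Fin d) × Fin M)) [IsProbabilityMeasure P]
    (hPX : P.fst = (volume : Measure (EuclideanSpace ℝ (Fin d))).restrict (unitCube d))
    (hd : 1 ≤ d) (η : EuclideanSpace ℝ (Fin d) → Fin M → ℝ) (hη : IsPosterior P η) {α cL : ℝ}
    (hα : 0 < α) (hcL : 0 < cL) (hH : HolderPosterior η α cL) (D : LabelledSample d M n)
    {k T : ℕ} (hk0 : 0 < k) {x : EuclideanSpace ℝ (Fin d)} (hx : x ∈ unitCube d)
    {z : Fin n → Bool} (hk : k ≤ ((firstPoints D x T).filter fun i => z i = true).card)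
    {h e : ℝ} (hT : ∀ i ∈ firstPoints D x T, dist (D i).1 x ≤ h)
    (hcount : ∀ r, 0 ≤ r → r ≤ h → ∀ m,
      sampleCount D m (Metric.closedBall x r) ≤ n * labelMass P m (Metric.ball x r) + e ∧
      n * labelMass P m (Metric.ball x r) - e ≤ sampleCount D m (Metric.ball x r)) :
    ∃ v, 0 ≤ v ∧ v ≤ h ^ d * unitBallVolume d ∧ ∀ m,
      |∑ i, activeIndicator D k x m i z - n * (η x m * v)|
        ≤ e + n * (cL * h ^ α * (h ^ d * unitBallVolume d)) := by
  have hacc : ∃ i₀, nnRank D z x i₀ < k := by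
    have h1 : k ≤ (Finset.univ.filter fun i => z i = true).card :=
      hk.trans (Finset.card_le_card (Finset.filter_subset_filter _ (Finset.subset_univ _)))
    have h2 := card_filter_nnRank_lt D z x h1
    obtain ⟨i, hi⟩ := Finset.card_pos.1 (h2.symm ▸ hk0)
    exact ⟨i, (Finset.mem_filter.1 hi).2.2⟩
  obtain ⟨i₀, hi₀⟩ := hacc
  obtain ⟨i₁, hi₁, hle, hge⟩ := exists_radius D z x hi₀
  set r := dist (D i₁).1 x with hr
  have hr0 : 0 ≤ r := dist_nonneg
  have hrh : r ≤ h := hT i₁ (mem_firstPoints_of_nnRank_lt D hk hi₁)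
  have hω := unitBallVolume_pos d
  -- The radius `r` is that of the farthest visited point. It depends on the bag but not on `m`, so
  -- the same mass serves all classes; visited points are squeezed between the open and the closed
  -- ball.
  refine ⟨P.fst.real (Metric.ball x r), measureReal_nonneg, ?_, fun m => ?_⟩
  · refine (fst_real_ball_le hPX hd x hr0).trans ?_
    gcongr
  · obtain ⟨hup, hlow⟩ := hcount r hr0 hrh m
    have h1 : ∑ i, activeIndicator D k x m i z ≤ sampleCount D m (Metric.closedBall x r) := by
      refine Finset.sum_le_sum fun i _ => ?_
      by_cases hi : nnRank D z x i < k ∧ (D i).2 = m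
      · have hmem : D i ∈ {p : EuclideanSpace ℝ (Fin d) × Fin M |
            p.1 ∈ Metric.closedBall x r ∧ p.2 = m} :=
          ⟨Metric.mem_closedBall.2 (hle i hi.1), hi.2⟩
        rw [activeIndicator, if_pos hi, Set.indicator_of_mem hmem]
      · rw [activeIndicator, if_neg hi]
        exact Set.indicator_nonneg (fun _ _ => zero_le_one) _
    have h2 : sampleCount D m (Metric.ball x r) ≤ ∑ i, activeIndicator D k x m i z := by
      refine Finset.sum_le_sum fun i _ => ?_
      by_cases hi : D i ∈ {p : EuclideanSpace ℝ (Fin d) × Fin M | p.1 ∈ Metric.ball x r ∧ p.2 = m}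
      · rw [Set.indicator_of_mem hi, activeIndicator,
          if_pos ⟨hge i (Metric.mem_ball.1 hi.1), hi.2⟩]
      · rw [Set.indicator_of_notMem hi, activeIndicator]
        split_ifs <;> norm_num
    have h3 := abs_labelMass_ball_sub_le P hPX η hη hα hcL hH hx m (r := r)
    have h4 : cL * r ^ α * P.fst.real (Metric.ball x r)
        ≤ cL * h ^ α * (h ^ d * unitBallVolume d) := by
      have := fst_real_ball_le hPX hd x hr0
      have h5 : r ^ α ≤ h ^ α := Real.rpow_le_rpow hr0 hrh hα.le
      have h6 : P.fst.real (Metric.ball x r) ≤ h ^ d * unitBallVolume d :=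
        this.trans (by gcongr)
      have h7 : 0 ≤ h ^ α := Real.rpow_nonneg (hr0.trans hrh) _
      exact mul_le_mul (mul_le_mul_of_nonneg_left h5 hcL.le) h6 measureReal_nonneg (by positivity)
    have h8 := abs_le.1 (h3.trans h4)
    have hn0 : (0 : ℝ) ≤ n := Nat.cast_nonneg n
    have h9 := mul_le_mul_of_nonneg_left h8.1 hn0
    have h10 := mul_le_mul_of_nonneg_left h8.2 hn0
    rw [abs_le]
    constructor <;> linarith

/-- Uniform estimation of the weighted posterior by the bagged estimate on the good event. -/
lemma abs_baggedEstimate_sub_le (P : Measure (EuclideanSpace ℝ (Fin d) × Fin M))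
    [IsProbabilityMeasure P]
    (hPX : P.fst = (volume : Measure (EuclideanSpace ℝ (Fin d))).restrict (unitCube d))
    (hd : 1 ≤ d) (hM : 0 < M) (η : EuclideanSpace ℝ (Fin d) → Fin M → ℝ) (hη : IsPosterior P η)
    {α cL : ℝ} (hα : 0 < α) (hcL : 0 < cL) (hH : HolderPosterior η α cL)
    {π₀ : ℝ} (hπ₀ : 0 < π₀) (hπ : ∀ m, π₀ ≤ classProb P m) (hn : 0 < n)
    (D : LabelledSample d M n) {k T B : ℕ} (hk0 : 0 < k) (hB : 0 < B)
    {x : EuclideanSpace ℝ (Fin d)} (hx : x ∈ unitCube d) (z : Fin B → Fin n → Bool)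
    (hk : ∀ b, k ≤ ((firstPoints D x T).filter fun i => z b i = true).card)
    {h e t s δ : ℝ} (hh : 0 ≤ h) (he : 0 ≤ e) (hs : 0 ≤ s)
    (hT : ∀ i ∈ firstPoints D x T, dist (D i).1 x ≤ h)
    (hcount : ∀ r, 0 ≤ r → r ≤ h → ∀ m,
      sampleCount D m (Metric.closedBall x r) ≤ n * labelMass P m (Metric.ball x r) + e ∧
      n * labelMass P m (Metric.ball x r) - e ≤ sampleCount D m (Metric.ball x r))
    (hclass : ∀ m, |(classCount D m : ℝ) - n * classProb P m| ≤ n * δ) (hδ : δ ≤ π₀ / 2)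
    (hdev : ∀ m, |∑ b, bagDeviation D s k T x m (z b)| ≤ t) (m : Fin M) :
    |baggedEstimate D z k x m - weightedPosterior P η x m|
      ≤ (1 + M) * (t / B + s / M * (2 * (e + n * (cL * h ^ α * (h ^ d * unitBallVolume d)))
          / (n * π₀) + 2 * (h ^ d * unitBallVolume d) * δ / π₀ ^ 2)) / k := by
  have hn' : (0 : ℝ) < n := by exact_mod_cast hn
  have hB' : (0 : ℝ) < B := by exact_mod_cast hB
  have hk' : (0 : ℝ) < k := by exact_mod_cast hk0
  have hM' : (0 : ℝ) < M := by exact_mod_cast hM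
  have hω := unitBallVolume_pos d
  have hpos : ∀ l, 0 < classProb P l := fun l => hπ₀.trans_le (hπ l)
  have hδ0 : 0 ≤ δ := by
    have := (abs_nonneg _).trans (hclass m)
    exact nonneg_of_mul_nonneg_right this hn'
  choose v hv0 hv1 hv using fun b => exists_mass_of_bag P hPX hd η hη hα hcL hH D hk0 hx
    (hk b) hT hcount
  set vbar := h ^ d * unitBallVolume d with hvbar
  have hvbar0 : 0 ≤ vbar := by positivity
  set e' := e + n * (cL * h ^ α * vbar) with he'
  have he'0 : 0 ≤ e' := by
    have : 0 ≤ h ^ α := Real.rpow_nonneg hh _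
    positivity
  set V := (1 / (B : ℝ)) * ∑ b, v b with hV
  set cnt : Fin B → Fin M → ℝ := fun b l =>
    ({i : Fin n | z b i = true ∧ nnRank D (z b) x i < k ∧ (D i).2 = l}.ncard : ℝ) with hcnt
  set u : Fin M → ℝ := fun l => (1 / (B : ℝ)) * ∑ b, cnt b l with hu
  have hest : ∀ l, baggedEstimate D z k x l = u l / k := by
    intro l
    simp only [baggedEstimate, knnEstimate, hu, hcnt, ← Finset.sum_div]
    ring
  have husum : ∑ l, u l = k := by
    simp only [hu, ← Finset.mul_sum]
    rw [Finset.sum_comm]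
    have : ∀ b, ∑ l, cnt b l = k := fun b => sum_ncard_nearest D x (z b)
      ((hk b).trans (Finset.card_le_card
        (Finset.filter_subset_filter _ (Finset.subset_univ _))))
    simp only [this]
    simp
    field_simp
  -- Martingale part plus compensator of the accepted count.
  have hcntdev : ∀ b l, cnt b l = bagDeviation D s k T x l (z b)
      + s / (M * classCount D l) * ∑ i, activeIndicator D k x l i (z b) := by
    intro b l
    rw [hcnt, bagDeviation, sum_firstPoints_mul_activeIndicator D (hk b) l]
    simp only [sub_mul, Finset.sum_sub_distrib]
    rw [sum_boolReal_mul_activeIndicator, sum_acceptProb_mul_activeIndicator]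
    ring
  have hcc : ∀ l, n * π₀ / 2 ≤ classCount D l := by
    intro l
    have h1 := (abs_le.1 (hclass l)).1
    have h2 := mul_le_mul_of_nonneg_left (hπ l) hn'.le
    have h3 := mul_le_mul_of_nonneg_left hδ hn'.le
    linarith
  have hmain : ∀ b l, |s / (M * classCount D l) * ∑ i, activeIndicator D k x l i (z b)
      - (s / M) * v b * (η x l / classProb P l)|
      ≤ s / M * (2 * e' / (n * π₀) + 2 * vbar * δ / π₀ ^ 2) := by
    intro b l
    set A := ∑ i, activeIndicator D k x l i (z b) with hA
    set N : ℝ := (classCount D l : ℝ) with hN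
    set p := classProb P l with hp
    have hNp : 0 < N := lt_of_lt_of_le (by positivity) (hcc l)
    have hpp : 0 < p := hpos l
    -- Separates the error of the visited count `A` from the error of replacing the class frequency
    -- `N` by `n * p`.
    have hid : s / (M * N) * A - (s / M) * v b * (η x l / p)
        = s / M * ((A - n * (η x l * v b)) / N + (η x l * v b) * ((n * p - N) / (N * p))) := by
      field_simp
      ring
    rw [hid, abs_mul, abs_of_nonneg (by positivity : 0 ≤ s / M)]
    refine mul_le_mul_of_nonneg_left ?_ (by positivity)
    refine (abs_add_le _ _).trans (add_le_add ?_ ?_)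
    · rw [abs_div, abs_of_pos hNp]
      calc |A - n * (η x l * v b)| / N ≤ e' / (n * π₀ / 2) :=
            div_le_div₀ he'0 (hv b l) (by positivity) (hcc l)
        _ = 2 * e' / (n * π₀) := by field_simp
    · rw [abs_mul, abs_div, abs_of_nonneg (mul_nonneg (hη.nonneg x hx l) (hv0 b)),
        abs_of_pos (mul_pos hNp hpp), abs_sub_comm]
      have h1 : η x l * v b ≤ 1 * vbar :=
        mul_le_mul (hη.le_one hx l) (hv1 b) (hv0 b) zero_le_one
      have h2 : |N - n * p| / (N * p) ≤ n * δ / (n * π₀ / 2 * π₀) :=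
        div_le_div₀ (by positivity) (hclass l) (by positivity)
          (mul_le_mul (hcc l) (hπ l) hπ₀.le hNp.le)
      calc η x l * v b * (|N - n * p| / (N * p)) ≤ (1 * vbar) * (n * δ / (n * π₀ / 2 * π₀)) :=
            mul_le_mul h1 h2 (by positivity) (by positivity)
        _ = 2 * vbar * δ / π₀ ^ 2 := by field_simp
  have hg0 : ∀ l, 0 ≤ η x l / classProb P l := fun l => div_nonneg (hη.nonneg x hx l) (hpos l).le
  have hgs : 0 < ∑ l, η x l / classProb P l := by
    have h1 : ∑ l, η x l ≤ ∑ l, η x l / classProb P l := by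
      refine Finset.sum_le_sum fun l _ => ?_
      rw [le_div_iff₀ (hpos l)]
      have : classProb P l ≤ 1 := measureReal_le_one
      nlinarith [hη.nonneg x hx l]
    rw [hη.sum_eq_one x hx] at h1
    linarith
  set K := s / M * (2 * e' / (n * π₀) + 2 * vbar * δ / π₀ ^ 2) with hK
  have hun : ∀ l, |u l - (s / M * V) * (η x l / classProb P l)| ≤ t / B + K := by
    intro l
    have hid : u l - (s / M * V) * (η x l / classProb P l)
        = (∑ b, bagDeviation D s k T x l (z b)) / B
          + (∑ b, (s / (M * classCount D l) * ∑ i, activeIndicator D k x l i (z b)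
            - (s / M) * v b * (η x l / classProb P l))) / B := by
      simp only [hu, hcntdev, hV, Finset.sum_add_distrib, Finset.sum_sub_distrib,
        ← Finset.sum_mul, ← Finset.mul_sum]
      ring
    rw [hid]
    refine (abs_add_le _ _).trans (add_le_add ?_ ?_)
    · rw [abs_div, abs_of_pos hB']
      exact div_le_div_of_nonneg_right (hdev l) hB'.le
    · rw [abs_div, abs_of_pos hB', div_le_iff₀ hB']
      refine (Finset.abs_sum_le_sum_abs _ _).trans
        ((Finset.sum_le_sum fun b _ => hmain b l).trans ?_)
      simp [mul_comm]
  rw [hest m, weightedPosterior]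
  exact abs_normalize_sub_le u _ hg0 hgs hk' hun husum m

end

/-! ### Rates and parameter choices -/

/-- The bandwidth `(log n / n)^{1/(2α+d)}`. -/
def bandwidth (d : ℕ) (α : ℝ) (n : ℕ) : ℝ := (Real.log n / n) ^ (1 / (2 * α + d))

section

variable {d : ℕ} {α : ℝ}

lemma log_div_self_pos {n : ℕ} (hn : 2 ≤ n) : 0 < Real.log n / n := by
  have : (1 : ℝ) < n := by exact_mod_cast hn
  have := Real.log_pos this
  positivity

lemma bandwidth_pos {n : ℕ} (hn : 2 ≤ n) : 0 < bandwidth d α n :=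
  Real.rpow_pos_of_pos (log_div_self_pos hn) _

lemma bandwidth_rpow {n : ℕ} (hn : 2 ≤ n) (e : ℝ) :
    bandwidth d α n ^ e = (Real.log n / n) ^ (e / (2 * α + d)) := by
  rw [bandwidth, ← Real.rpow_mul (log_div_self_pos hn).le]
  congr 1
  ring

lemma bandwidth_pow_dim {n : ℕ} (hn : 2 ≤ n) :
    bandwidth d α n ^ d = (Real.log n / n) ^ ((d : ℝ) / (2 * α + d)) := by
  rw [← bandwidth_rpow hn, Real.rpow_natCast]

/-- The balance of bias and fluctuation: at radius `τ` the bias `τ ^ α` equals the relative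
deviation `√(log n / (n τ ^ d))` of a count of order `n τ ^ d`. -/
lemma bandwidth_identity (hα : 0 < α) {n : ℕ} (hn : 2 ≤ n) :
    n * bandwidth d α n ^ d * (bandwidth d α n ^ α) ^ 2 = Real.log n := by
  have hn' : (0 : ℝ) < n := by positivity
  have hκ : 0 < 2 * α + d := by positivity
  rw [bandwidth_pow_dim hn, bandwidth_rpow hn, ← Real.rpow_natCast, ← Real.rpow_mul
    (log_div_self_pos hn).le, mul_assoc, ← Real.rpow_add (log_div_self_pos hn)]
  have : (d : ℝ) / (2 * α + d) + α / (2 * α + d) * ((2 : ℕ) : ℝ) = 1 := by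
    push_cast
    field_simp
    ring
  rw [this, Real.rpow_one]
  field_simp

lemma tendsto_log_div_self : Filter.Tendsto (fun r : ℝ => Real.log r / r) Filter.atTop (nhds 0) := by
  have := Real.isLittleO_log_id_atTop
  exact this.tendsto_div_nhds_zero

lemma tendsto_bandwidth (hα : 0 < α) :
    Filter.Tendsto (bandwidth d α) Filter.atTop (nhds 0) := by
  have hκ : 0 < 1 / (2 * α + d) := by positivity
  have h1 := (tendsto_log_div_self.comp tendsto_natCast_atTop_atTop).rpow_const
    (p := 1 / (2 * α + d)) (Or.inr hκ.le)
  rw [Real.zero_rpow hκ.ne'] at h1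
  exact h1

/-- The bandwidth facts used for large sample sizes. -/
lemma eventually_bandwidth (hα : 0 < α) (hd : 1 ≤ d) {κ R : ℝ} (hκ : 0 < κ) :
    ∀ᶠ n : ℕ in Filter.atTop, 2 ≤ n ∧ 0 < bandwidth d α n ∧ bandwidth d α n ≤ 1 ∧
      bandwidth d α n ≤ κ ∧ bandwidth d α n ^ α ≤ κ ∧ R ≤ Real.log n ∧
      Real.log n ≤ n * bandwidth d α n ^ d * bandwidth d α n ^ α ∧
      Real.log n ≤ n * bandwidth d α n ^ d ∧ Real.log n ≤ n * bandwidth d α n ∧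
      Real.log n ≤ n * (bandwidth d α n ^ α) ^ 2 := by
  have hτlim := tendsto_bandwidth (d := d) hα
  have hεlim : Filter.Tendsto (fun n => bandwidth d α n ^ α) Filter.atTop (nhds 0) := by
    have := hτlim.rpow_const (p := α) (Or.inr hα.le)
    rwa [Real.zero_rpow hα.ne'] at this
  filter_upwards [Filter.eventually_ge_atTop 2,
    hτlim.eventually_le_const (show (0 : ℝ) < min 1 κ by positivity),
    hεlim.eventually_le_const (show (0 : ℝ) < min 1 κ by positivity),
    (Real.tendsto_log_atTop.comp tendsto_natCast_atTop_atTop).eventually_ge_atTop R]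
    with n hn hτ hε hlog
  have hτ0 : 0 < bandwidth d α n := bandwidth_pos hn
  have hid := bandwidth_identity (d := d) hα hn
  set τ := bandwidth d α n
  have hε0 : 0 < τ ^ α := Real.rpow_pos_of_pos hτ0 _
  set ε := τ ^ α
  have hτ1 : τ ≤ 1 := hτ.trans (min_le_left _ _)
  have hε1 : ε ≤ 1 := hε.trans (min_le_left _ _)
  have hτd0 : 0 < τ ^ d := pow_pos hτ0 _
  have hL1 : Real.log n ≤ n * τ ^ d * ε := by
    rw [← hid]
    refine mul_le_mul_of_nonneg_left ?_ (by positivity)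
    rw [sq]
    exact mul_le_of_le_one_left hε0.le hε1
  have hL2 : Real.log n ≤ n * τ ^ d :=
    hL1.trans (mul_le_of_le_one_right (by positivity) hε1)
  refine ⟨hn, hτ0, hτ1, hτ.trans (min_le_right _ _), hε.trans (min_le_right _ _), hlog, hL1, hL2,
    hL2.trans ?_, ?_⟩
  · refine mul_le_mul_of_nonneg_left ?_ (by positivity)
    calc τ ^ d ≤ τ ^ 1 := pow_le_pow_of_le_one hτ0.le hτ1 hd
      _ = τ := pow_one _
  · rw [← hid]
    refine mul_le_mul_of_nonneg_right ?_ (by positivity)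
    exact mul_le_of_le_one_right (by positivity) (pow_le_one₀ hτ0.le hτ1)

/-- Both regimes take the form `r q ^ μ` with `q = log r / r`. What matters is `μ + d/(2α+d) ≤ 1`:
then `s q ^ (d/(2α+d))`, the unrounded `k`, is at least of order `r q = log r` once `q ≤ 1`. -/
lemma subsampleOrder_eq (hα : 0 < α) :
    ∃ μ : ℝ, 0 < μ ∧ μ + (d : ℝ) / (2 * α + d) ≤ 1 ∧
      ∀ r, 1 < r → subsampleOrder d α r = r * (Real.log r / r) ^ μ := by
  have hκ : 0 < 2 * α + d := by positivity
  by_cases h : 2 * α < d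
  · refine ⟨2 * α / (2 * α + d), by positivity, ?_, fun r hr => ?_⟩
    · rw [← add_div, div_self hκ.ne']
    · have hr0 : 0 < r := by linarith
      rw [subsampleOrder, if_pos h, Real.div_rpow (Real.log_pos hr).le hr0.le]
      have : r ^ ((d : ℝ) / (2 * α + d)) * r ^ (2 * α / (2 * α + d)) = r := by
        rw [← Real.rpow_add hr0, ← add_div, add_comm, div_self hκ.ne', Real.rpow_one]
      have h2 : 0 < r ^ (2 * α / (2 * α + d)) := Real.rpow_pos_of_pos hr0 _
      field_simp
      rw [mul_comm _ (r ^ _), ← mul_assoc, mul_comm (r ^ (2 * α / (2 * α + d))), this,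
        mul_comm]
  · refine ⟨1 / 2, by norm_num, ?_, fun r hr => ?_⟩
    · have : (d : ℝ) / (2 * α + d) ≤ 1 / 2 := by
        rw [div_le_div_iff₀ hκ two_pos]
        linarith
      linarith
    · have hr0 : 0 < r := by linarith
      have hl := Real.log_pos hr
      rw [subsampleOrder, if_neg h, ← Real.sqrt_eq_rpow, ← Real.sqrt_eq_rpow]
      rw [show r * Real.log r = r ^ 2 * (Real.log r / r) by field_simp,
        Real.sqrt_mul (sq_nonneg r), Real.sqrt_sq hr0.le]

/-- Consequences of the prescribed choice of the parameters for `r = ρ n` of order `n`. -/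
lemma eventually_parameterChoice (hα : 0 < α) (hd : 1 ≤ d) {c : ℝ} (hc : 0 < c) {p : ℝ}
    (hp : 0 < p) (hp1 : p ≤ 1) :
    ∀ᶠ n : ℕ in Filter.atTop, ∀ r : ℝ, p * n ≤ r → r ≤ n →
      (∃ (s' : ℝ) (B' k' : ℕ), IsParameterChoice d α c r s' B' k') ∧
      ∀ (s : ℝ) (B k : ℕ), IsParameterChoice d α c r s B k →
        1 ≤ s ∧ s ≤ r ∧ 0 < k ∧ 0 < B ∧ (B : ℝ) ≤ n + 1 ∧
        (k : ℝ) ≤ 2 / p * (s * bandwidth d α n ^ d) ∧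
        s * bandwidth d α n ^ d / 4 ≤ k ∧
        p * c / 2 * Real.log n ≤ s * bandwidth d α n ^ d ∧
        p * n / 2 ≤ B * s := by
  obtain ⟨μ, hμ, hμγ, hord⟩ := subsampleOrder_eq (d := d) hα
  set γ : ℝ := (d : ℝ) / (2 * α + d) with hγ
  have hκ : 0 < 2 * α + d := by positivity
  have hγ0 : 0 < γ := by
    have : (0 : ℝ) < d := by exact_mod_cast hd
    positivity
  have hγ1 : γ ≤ 1 := by linarith
  have hq0 : Filter.Tendsto (fun r : ℝ => c * (Real.log r / r) ^ μ) Filter.atTop (nhds 0) := by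
    have h1 := (tendsto_log_div_self.rpow_const (p := μ) (Or.inr hμ.le)).const_mul c
    rwa [Real.zero_rpow hμ.ne', mul_zero] at h1
  have hR : ∀ᶠ r : ℝ in Filter.atTop, 1 < r ∧ 2 / c ≤ Real.log r ∧ Real.log r / r ≤ 1 ∧
      c * (Real.log r / r) ^ μ ≤ 1 :=
    (Filter.eventually_gt_atTop 1).and
      ((Real.tendsto_log_atTop.eventually_ge_atTop _).and
        ((tendsto_log_div_self.eventually_le_const one_pos).and
          (hq0.eventually_le_const one_pos)))
  obtain ⟨R, hR⟩ := Filter.eventually_atTop.1 hR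
  have hlim : Filter.Tendsto (fun n : ℕ => p * (n : ℝ)) Filter.atTop Filter.atTop :=
    tendsto_natCast_atTop_atTop.const_mul_atTop hp
  filter_upwards [Filter.eventually_ge_atTop 2, hlim.eventually_ge_atTop R,
    (Real.tendsto_log_atTop.comp tendsto_natCast_atTop_atTop).eventually_ge_atTop
      (-2 * Real.log p)] with n hn hnR hnp r hr1 hr2
  have hn' : (0 : ℝ) < n := by positivity
  obtain ⟨h1, h2, h3, h4⟩ := hR r (hnR.trans hr1)
  have hr0 : 0 < r := by linarith
  have hlr := Real.log_pos h1
  set q := Real.log r / r with hq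
  have hqpos : 0 < q := by positivity
  have hord' : c * subsampleOrder d α r ≤ r := by
    rw [hord r h1]
    nlinarith
  have hτ : bandwidth d α n ^ d = (Real.log n / n) ^ γ := bandwidth_pow_dim hn
  set τd := bandwidth d α n ^ d with hτd
  have hτ0 : 0 < τd := pow_pos (bandwidth_pos hn) _
  have hlog1 : Real.log n / 2 ≤ Real.log r := by
    have h5 : Real.log (p * n) ≤ Real.log r := Real.log_le_log (by positivity) hr1
    rw [Real.log_mul hp.ne' hn'.ne'] at h5
    have h6 : -2 * Real.log p ≤ Real.log n := hnp
    linarith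
  have hlog2 : Real.log r ≤ Real.log n := Real.log_le_log hr0 hr2
  have hlog0 : 0 < Real.log n := by linarith
  have hl1 : τd / 2 ≤ q ^ γ := by
    have h5 : (1 / 2) * (Real.log n / n) ≤ q := by
      rw [hq, show (1 / 2) * (Real.log n / n) = (Real.log n / 2) / n by ring]
      exact div_le_div₀ hlr.le hlog1 hr0 hr2
    calc τd / 2 = (1 / 2) ^ (1 : ℝ) * (Real.log n / n) ^ γ := by rw [hτ, Real.rpow_one]; ring
      _ ≤ (1 / 2) ^ γ * (Real.log n / n) ^ γ := by
          refine mul_le_mul_of_nonneg_right ?_ (by positivity)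
          exact Real.rpow_le_rpow_of_exponent_ge (by norm_num) (by norm_num) hγ1
      _ = ((1 / 2) * (Real.log n / n)) ^ γ := by
          rw [Real.mul_rpow (by norm_num) (by positivity)]
      _ ≤ q ^ γ := Real.rpow_le_rpow (by positivity) h5 hγ0.le
  have hl2 : q ^ γ ≤ τd / p := by
    have h5 : q ≤ (1 / p) * (Real.log n / n) := by
      rw [hq, show (1 / p) * (Real.log n / n) = Real.log n / (p * n) by field_simp]
      exact div_le_div₀ hlog0.le hlog2 (by positivity) hr1
    calc q ^ γ ≤ ((1 / p) * (Real.log n / n)) ^ γ := Real.rpow_le_rpow hqpos.le h5 hγ0.le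
      _ = (1 / p) ^ γ * (Real.log n / n) ^ γ := by
          rw [Real.mul_rpow (by positivity) (by positivity)]
      _ ≤ (1 / p) ^ (1 : ℝ) * (Real.log n / n) ^ γ := by
          refine mul_le_mul_of_nonneg_right ?_ (by positivity)
          refine Real.rpow_le_rpow_of_exponent_le ?_ hγ1
          rw [le_div_iff₀ hp]
          linarith
      _ = τd / p := by rw [hτ, Real.rpow_one]; ring
  constructor
  -- The full expected size `s = r` with one bag is always admissible for large `n`, so the
  -- prescription is never void.
  · refine ⟨r, 1, ⌊r * q ^ γ⌋₊, h1.le, le_rfl, hord', ?_, ?_⟩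
    · rw [div_self hr0.ne']; norm_num
    · have h5 : 0 ≤ r * q ^ γ := by positivity
      rw [abs_lt]
      constructor <;> linarith [Nat.floor_le h5, Nat.lt_floor_add_one (r * q ^ γ)]
  · rintro s B k ⟨hs1, hsr, hso, hB, hk⟩
    have hs0 : 0 < s := by linarith
    have hsl : c * Real.log r ≤ s * q ^ γ := by
      have h5 : Real.log r ≤ subsampleOrder d α r * q ^ γ := by
        rw [hord r h1, mul_assoc, ← hq, ← Real.rpow_add hqpos]
        calc Real.log r = r * q ^ (1 : ℝ) := by rw [Real.rpow_one, hq]; field_simp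
          _ ≤ r * q ^ (μ + γ) := by
              refine mul_le_mul_of_nonneg_left ?_ hr0.le
              exact Real.rpow_le_rpow_of_exponent_ge hqpos h3 hμγ
      calc c * Real.log r ≤ c * (subsampleOrder d α r * q ^ γ) :=
            mul_le_mul_of_nonneg_left h5 hc.le
        _ = (c * subsampleOrder d α r) * q ^ γ := by ring
        _ ≤ s * q ^ γ := mul_le_mul_of_nonneg_right hso (by positivity)
    -- The unrounded `k` is at least `2`, so rounding changes it by a factor between `1/2` and `2`.
    have hsl2 : 2 ≤ s * q ^ γ := by
      refine le_trans ?_ hsl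
      rwa [div_le_iff₀ hc, mul_comm] at h2
    have hk1 := (abs_lt.1 hk).1
    have hk2 := (abs_lt.1 hk).2
    have hB1 := (abs_lt.1 hB).1
    have hB2 := (abs_lt.1 hB).2
    have hrs : 1 ≤ r / s := by rw [le_div_iff₀ hs0]; linarith
    have hBpos : 0 < B := by
      have : (0 : ℝ) < B := by linarith
      exact_mod_cast this
    have hBone : (1 : ℝ) ≤ B := by exact_mod_cast hBpos
    have hm1 := mul_le_mul_of_nonneg_left hl1 hs0.le
    have hm2 := mul_le_mul_of_nonneg_left hl2 hs0.le
    refine ⟨hs1, hsr, ?_, hBpos, ?_, ?_, ?_, ?_, ?_⟩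
    · have : (0 : ℝ) < k := by linarith
      exact_mod_cast this
    · have : r / s ≤ r := div_le_self hr0.le hs1
      linarith
    · have : 2 / p * (s * τd) = 2 * (s * (τd / p)) := by ring
      rw [this]
      linarith
    · linarith
    · have h5 : c * (Real.log n / 2) ≤ s * (τd / p) :=
        (mul_le_mul_of_nonneg_left hlog1 hc.le).trans (hsl.trans hm2)
      have h6 := mul_le_mul_of_nonneg_left h5 hp.le
      have h7 : p * (s * (τd / p)) = s * τd := by field_simp
      linarith
    -- Since `B ≥ 1`, rounding at most halves `r / s`.
    · have h5 : r / s / 2 ≤ B := by linarith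
      have h6 : r / 2 ≤ B * s := by
        have := mul_le_mul_of_nonneg_right h5 hs0.le
        have h7 : r / s / 2 * s = r / 2 := by field_simp
        linarith
      linarith

end

/-! ### The good events have high probability -/

/-- The exponent in the union bounds. -/
def unionExponent (d : ℕ) : ℕ := 3 * d + 10

lemma exp_neg_mul_log {n : ℕ} (hn : 0 < n) (a : ℕ) :
    Real.exp (-(a * Real.log n)) = 1 / (n : ℝ) ^ a := by
  have hn' : (0 : ℝ) < n := by exact_mod_cast hn
  rw [Real.exp_neg, mul_comm, Real.exp_mul, Real.exp_log hn', Real.rpow_natCast, one_div]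

/-- Grid balls and classes are polynomially many; the exponent `3 * d + 10` beats their number and
leaves `n ^ 2` to spare. -/
lemma sample_union_bound (d : ℕ) {M n : ℕ} (hn : 4 ≤ n) (hMn : 2 * M ≤ n) :
    ((n : ℝ) + 1) ^ d * (2 * n + 1) * M * (2 * (1 / (n : ℝ) ^ unionExponent d))
      + M * (2 * (1 / (n : ℝ) ^ unionExponent d)) ≤ 1 / (n : ℝ) ^ 2 := by
  have hn' : (4 : ℝ) ≤ n := by exact_mod_cast hn
  have hM' : (2 : ℝ) * M ≤ n := by exact_mod_cast hMn
  have hn0 : (0 : ℝ) < n := by linarith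
  have h1 : ((n : ℝ) + 1) ^ d ≤ (n : ℝ) ^ (3 * d) := by
    rw [pow_mul]
    exact pow_le_pow_left₀ (by positivity) (by nlinarith [mul_pos hn0 hn0]) _
  have h2 : (2 * (n : ℝ) + 1) ≤ n ^ 2 := by nlinarith
  have h3 : (1 : ℝ) ≤ n ^ (3 * d) := one_le_pow₀ (by linarith)
  have h4 : ((n : ℝ) + 1) ^ d * (2 * n + 1) * (2 * M) + 2 * M ≤ n ^ (3 * d + 8) := by
    calc ((n : ℝ) + 1) ^ d * (2 * n + 1) * (2 * M) + 2 * M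
        ≤ n ^ (3 * d) * n ^ 2 * n + n ^ (3 * d) * n := by
          refine add_le_add (by gcongr) ?_
          nlinarith
      _ = n ^ (3 * d) * (n ^ 3 + n) := by ring
      _ ≤ n ^ (3 * d) * n ^ 8 := by
          gcongr
          have h5 : (n : ℝ) ^ 3 + n ≤ n ^ 4 := by
            have h7 : (1 : ℝ) ≤ n ^ 2 := one_le_pow₀ (by linarith)
            have h8 : (n : ℝ) * 1 ≤ n * n ^ 2 := by gcongr
            have h9 : 4 * (n : ℝ) ^ 3 ≤ n * n ^ 3 := by gcongr
            nlinarith [pow_pos hn0 3]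
          exact h5.trans (pow_le_pow_right₀ (by linarith) (by norm_num))
      _ = _ := by rw [← pow_add]
  have h6 : ((n : ℝ) + 1) ^ d * (2 * n + 1) * M * (2 * (1 / (n : ℝ) ^ unionExponent d))
      + M * (2 * (1 / (n : ℝ) ^ unionExponent d))
      = (((n : ℝ) + 1) ^ d * (2 * n + 1) * (2 * M) + 2 * M) / n ^ unionExponent d := by ring
  rw [h6, div_le_div_iff₀ (by positivity) (by positivity), one_mul]
  calc _ ≤ (n : ℝ) ^ (3 * d + 8) * n ^ 2 := by gcongr
    _ = _ := by rw [← pow_add]; rfl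

lemma bag_union_bound (d : ℕ) {M n : ℕ} {B : ℝ} (hn : 4 ≤ n) (hMn : 2 * M ≤ n)
    (hB : B ≤ n + 1) :
    ((n : ℝ) ^ 2 + 1) ^ (d + 1) * (B * (2 * (1 / (n : ℝ) ^ unionExponent d))
      + M * (2 * (1 / (n : ℝ) ^ unionExponent d))) ≤ 1 / (n : ℝ) ^ 2 := by
  have hn' : (4 : ℝ) ≤ n := by exact_mod_cast hn
  have hM' : (2 : ℝ) * M ≤ n := by exact_mod_cast hMn
  have hn0 : (0 : ℝ) < n := by linarith
  have h0 : (n : ℝ) ^ 2 + 1 ≤ n ^ 3 := by nlinarith [mul_pos hn0 hn0]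
  have h1 : ((n : ℝ) ^ 2 + 1) ^ (d + 1) ≤ (n : ℝ) ^ (3 * (d + 1)) := by
    rw [pow_mul]
    exact pow_le_pow_left₀ (by positivity) h0 _
  have h2 : 2 * B + 2 * M ≤ n ^ 2 := by nlinarith
  have h6 : ((n : ℝ) ^ 2 + 1) ^ (d + 1) * (B * (2 * (1 / (n : ℝ) ^ unionExponent d))
      + M * (2 * (1 / (n : ℝ) ^ unionExponent d)))
      = (((n : ℝ) ^ 2 + 1) ^ (d + 1) * (2 * B + 2 * M)) / n ^ unionExponent d := by ring
  rw [h6, div_le_div_iff₀ (by positivity) (by positivity), one_mul]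
  calc ((n : ℝ) ^ 2 + 1) ^ (d + 1) * (2 * B + 2 * M) * n ^ 2
      ≤ ((n : ℝ) ^ 2 + 1) ^ (d + 1) * n ^ 2 * n ^ 2 := by gcongr
    _ ≤ (n : ℝ) ^ (3 * (d + 1)) * n ^ 2 * n ^ 2 := by gcongr
    _ = n ^ (3 * d + 7) := by rw [← pow_add, ← pow_add]; congr 1
    _ ≤ n ^ unionExponent d := pow_le_pow_right₀ (by linarith) (by unfold unionExponent; omega)

section

variable {d M n : ℕ}

/-- The sample has the expected class frequencies and the expected counts in balls of radius at
most `h` centred in the cube. -/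
structure GoodSample (P : Measure (EuclideanSpace ℝ (Fin d) × Fin M)) (D : LabelledSample d M n)
    (h e δ : ℝ) : Prop where
  classFreq : ∀ m, |(classCount D m : ℝ) - n * classProb P m| ≤ n * δ
  ballCount : ∀ x ∈ unitCube d, ∀ r, 0 ≤ r → r ≤ h → ∀ m,
      sampleCount D m (Metric.closedBall x r) ≤ n * labelMass P m (Metric.ball x r) + e ∧
      n * labelMass P m (Metric.ball x r) - e ≤ sampleCount D m (Metric.ball x r)

/-- Counts in balls of radius of order `τ` have mean of order at most `n τ ^ d`, and by
`bandwidth_identity` the uniform deviation `√(n τ ^ d log n)` is exactly `n τ ^ d τ ^ α`. -/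
lemma eventually_goodSample (P : Measure (EuclideanSpace ℝ (Fin d) × Fin M))
    [IsProbabilityMeasure P]
    (hPX : P.fst = (volume : Measure (EuclideanSpace ℝ (Fin d))).restrict (unitCube d))
    (hd : 1 ≤ d) {α : ℝ} (hα : 0 < α) {lam : ℝ} (hlam : 0 < lam) :
    ∃ K : ℝ, 0 < K ∧ ∀ᶠ n : ℕ in Filter.atTop,
      (Measure.pi fun _ : Fin n => P).real {D | ¬ GoodSample P D (lam * bandwidth d α n)
        (K * (n * bandwidth d α n ^ d * bandwidth d α n ^ α)) (K * bandwidth d α n ^ α)}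
      ≤ 1 / (n : ℝ) ^ 2 := by
  have hω := unitBallVolume_pos d
  -- The factor `2` makes room for the grid enlargement `(2 * d + 2) / n ≤ lam * τ` of the radius.
  set Q : ℝ := (2 * lam) ^ d * unitBallVolume d with hQ
  have hQ0 : 0 < Q := by positivity
  set a := unionExponent d with ha
  -- Chosen so that both exponents are at least `a * log n`: the summand `Q` serves the ball counts,
  -- the summand `1` the class frequencies. The final constant `K₁ + 1` also absorbs `gridError d`.
  set K₁ : ℝ := Real.sqrt (4 * a * (Q + 1)) with hK₁
  have hK₁0 : 0 ≤ K₁ := Real.sqrt_nonneg _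
  have hK₁sq : K₁ ^ 2 = 4 * a * (Q + 1) := Real.sq_sqrt (by positivity)
  refine ⟨K₁ + 1, by positivity, ?_⟩
  filter_upwards [Filter.eventually_ge_atTop 4, Filter.eventually_ge_atTop (2 * M),
    Filter.eventually_ge_atTop (2 * d + 2),
    eventually_bandwidth (d := d) hα hd (κ := min (1 / lam) (min (2 * Q / (K₁ + 1)) (2 / (K₁ + 1))))
      (R := gridError d + (2 * d + 2) / lam) (by positivity)]
    with n hn4 hnM hnd ⟨_, hτ0, hτ1, hτκ, hεκ, hlog, hL1, _, hL2, hL3⟩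
  have hn0 : 0 < n := by omega
  have hn' : (0 : ℝ) < n := by exact_mod_cast hn0
  have hid := bandwidth_identity (d := d) hα (n := n) (by omega)
  set τ := bandwidth d α n with hτdef
  have hε0 : 0 < τ ^ α := Real.rpow_pos_of_pos hτ0 _
  set ε := τ ^ α with hεdef
  have hτlam : lam * τ ≤ 1 := by
    have := hτκ.trans (min_le_left _ _)
    rwa [le_div_iff₀ hlam, mul_comm] at this
  have hεQ : K₁ * ε ≤ 2 * Q := by
    have := hεκ.trans ((min_le_right _ _).trans (min_le_left _ _))
    rw [le_div_iff₀ (by positivity)] at this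
    linarith
  have hε2 : K₁ * ε ≤ 2 := by
    have := hεκ.trans ((min_le_right _ _).trans (min_le_right _ _))
    rw [le_div_iff₀ (by positivity)] at this
    linarith
  have hge := gridError_nonneg d
  have hτd0 : 0 < τ ^ d := pow_pos hτ0 _
  have hgrid : (2 * d + 2 : ℝ) / n ≤ lam * τ := by
    rw [div_le_iff₀ hn']
    have h1 : (2 * d + 2 : ℝ) / lam ≤ n * τ := by linarith
    rw [div_le_iff₀ hlam] at h1
    linarith
  have hb1 := measureReal_grid_deviation_le P hPX hn0 (h' := lam * τ + (2 * d + 2) / n)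
    (q := Q * τ ^ d) (t := K₁ * (n * τ ^ d * ε))
    (by
      rw [hQ, mul_assoc, mul_comm (unitBallVolume d), ← mul_assoc, ← mul_pow]
      refine mul_le_mul_of_nonneg_right (pow_le_pow_left₀ (by positivity) ?_ _) hω.le
      linarith)
    (by positivity) (by positivity)
    (by
      have := mul_le_mul_of_nonneg_left hεQ (by positivity : 0 ≤ n * τ ^ d)
      linarith)
  have hb2 := measureReal_classCount_deviation_le P hn0 (t := n * (K₁ * ε)) (by positivity)
    (by
      have := mul_le_mul_of_nonneg_left hε2 hn'.le
      linarith)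
  have he1 : Real.exp (-((K₁ * (n * τ ^ d * ε)) ^ 2 / (4 * (n * (Q * τ ^ d)))))
      ≤ 1 / (n : ℝ) ^ a := by
    rw [← exp_neg_mul_log hn0, Real.exp_le_exp, neg_le_neg_iff, le_div_iff₀ (by positivity)]
    have : (K₁ * (n * τ ^ d * ε)) ^ 2 = K₁ ^ 2 * (n * τ ^ d) * (n * τ ^ d * ε ^ 2) := by ring
    rw [this, hid, hK₁sq]
    have h1 : 0 ≤ a * Real.log n * (n * τ ^ d) := by
      have : 0 ≤ Real.log n := Real.log_natCast_nonneg n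
      positivity
    linarith
  have he2 : Real.exp (-((n * (K₁ * ε)) ^ 2 / (4 * n))) ≤ 1 / (n : ℝ) ^ a := by
    rw [← exp_neg_mul_log hn0, Real.exp_le_exp, neg_le_neg_iff, le_div_iff₀ (by positivity)]
    have : (n * (K₁ * ε)) ^ 2 = K₁ ^ 2 * n * (n * ε ^ 2) := by ring
    rw [this, hK₁sq]
    have h2 := mul_le_mul_of_nonneg_left hL3 (by positivity : 0 ≤ 4 * (a : ℝ) * n)
    have h3 : 0 ≤ 4 * a * Q * n * (n * ε ^ 2) := by positivity
    linarith
  refine le_trans (measureReal_mono ?_) ((measureReal_union_le _ _).trans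
    ((add_le_add (hb1.trans (mul_le_mul_of_nonneg_left
      (mul_le_mul_of_nonneg_left he1 two_pos.le) (by positivity)))
      (hb2.trans (mul_le_mul_of_nonneg_left
        (mul_le_mul_of_nonneg_left he2 two_pos.le) (by positivity)))).trans
      (sample_union_bound d hn4 hnM)))
  intro D hD
  by_contra hnot
  rw [Set.mem_union, not_or] at hnot
  obtain ⟨hng, hnc⟩ := hnot
  refine hD ⟨fun m => ?_, fun x hx r hr hrh m => ?_⟩
  · have h1 : ¬ n * (K₁ * ε) ≤ |(classCount D m : ℝ) - n * classProb P m| := fun h => hnc ⟨m, h⟩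
    have h2 : (n : ℝ) * (K₁ * ε) ≤ n * ((K₁ + 1) * ε) := by
      gcongr
      linarith
    linarith
  · have h1 := sampleCount_ball_of_grid P hPX hd hnd D hτlam (t := K₁ * (n * τ ^ d * ε))
      (by positivity) (fun g j m hj => by
        by_contra h
        exact hng ⟨g, j, m, hj, (not_le.1 h).le⟩) hx hr hrh m
    have h2 : gridError d ≤ n * τ ^ d * ε := by
      have : 0 ≤ (2 * d + 2) / lam := by positivity
      linarith
    constructor <;> linarith [h1.1, h1.2]

/-- If the ball around `x` contains at least `T` sample points, then it contains the first `T`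
of them. -/
lemma dist_le_of_mem_firstPoints (D : LabelledSample d M n) {x : EuclideanSpace ℝ (Fin d)} {h : ℝ}
    {T : ℕ} (hT : (T : ℝ) ≤ ∑ m, sampleCount D m (Metric.ball x h)) :
    (∀ i ∈ firstPoints D x T, dist (D i).1 x ≤ h) ∧ T ≤ n := by
  classical
  have hcard : ∑ m, sampleCount D m (Metric.ball x h)
      = ((Finset.univ.filter fun i => dist (D i).1 x < h).card : ℝ) := by
    rw [Finset.card_eq_sum_card_fiberwise (f := fun i => (D i).2) (t := Finset.univ)
      (fun _ _ => by simp)]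
    push_cast
    refine Finset.sum_congr rfl fun m _ => ?_
    rw [sampleCount_eq_card, Finset.filter_filter]
    simp only [Metric.mem_ball]
  rw [hcard] at hT
  have hT' : T ≤ (Finset.univ.filter fun i => dist (D i).1 x < h).card := by exact_mod_cast hT
  refine ⟨fun i hi => ?_, hT'.trans ((Finset.card_le_univ _).trans (by simp))⟩
  by_contra hlt
  have hi' : nnRank D (fun _ => true) x i < T := (Finset.mem_filter.1 hi).2
  have hsub : ((Finset.univ.filter fun i => dist (D i).1 x < h : Finset (Fin n)) : Set (Fin n)) ⊆
      {j | (fun _ => true : Fin n → Bool) j = true ∧ Precedes D x j i} := by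
    intro j hj
    have hj' : dist (D j).1 x < h := (Finset.mem_filter.1 hj).2
    exact ⟨rfl, Or.inl (hj'.trans (not_le.1 hlt))⟩
  have := Set.ncard_le_ncard hsub (Set.toFinite _)
  rw [Set.ncard_coe_finset, ← nnRank_eq] at this
  omega

lemma sum_classProb (P : Measure (EuclideanSpace ℝ (Fin d) × Fin M)) [IsProbabilityMeasure P] :
    ∑ m, classProb P m = 1 := by
  have h := sum_labelMass P (A := Set.univ) MeasurableSet.univ
  simp only [labelMass_univ] at h
  rw [h, measureReal_def, Measure.fst_univ, measure_univ]
  rfl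

lemma sum_classCount (D : LabelledSample d M n) : ∑ m, classCount D m = n := by
  have := Finset.card_eq_sum_card_fiberwise (f := fun i => (D i).2)
    (s := (Finset.univ : Finset (Fin n))) (t := Finset.univ) (fun _ _ => by simp)
  simpa [classCount] using this.symm

lemma imbalanceRatio_mul (D : LabelledSample d M n) (hn : 0 < n) :
    imbalanceRatio D * n = M * minorityCount D := by
  have : (n : ℝ) ≠ 0 := by positivity
  rw [imbalanceRatio]
  field_simp

lemma minorityCount_le (D : LabelledSample d M n) (m : Fin M) :
    minorityCount D ≤ classCount D m := ciInf_le' _ m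

lemma imbalanceRatio_mul_le (D : LabelledSample d M n) (hn : 0 < n) :
    imbalanceRatio D * n ≤ n := by
  rw [imbalanceRatio_mul D hn]
  have h : ∑ _m : Fin M, minorityCount D ≤ ∑ m, classCount D m :=
    Finset.sum_le_sum fun m _ => minorityCount_le D m
  rw [sum_classCount] at h
  simp only [Finset.sum_const, Finset.card_univ, Fintype.card_fin, smul_eq_mul] at h
  exact_mod_cast h

lemma le_classCount_of_freq {P : Measure (EuclideanSpace ℝ (Fin d) × Fin M)}
    {D : LabelledSample d M n} {π₀ δ : ℝ} (hπ : ∀ m, π₀ ≤ classProb P m)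
    (hfreq : ∀ m, |(classCount D m : ℝ) - n * classProb P m| ≤ n * δ) (hδ : δ ≤ π₀ / 2)
    (m : Fin M) : n * π₀ / 2 ≤ classCount D m := by
  have hn' : (0 : ℝ) ≤ n := Nat.cast_nonneg n
  have h1 := (abs_le.1 (hfreq m)).1
  have h2 := mul_le_mul_of_nonneg_left (hπ m) hn'
  have h3 := mul_le_mul_of_nonneg_left hδ hn'
  linarith

lemma le_imbalanceRatio_mul (hM : 0 < M) (hn : 0 < n) {D : LabelledSample d M n} {π₀ : ℝ}
    (hcc : ∀ m, n * π₀ / 2 ≤ classCount D m) :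
    M * π₀ / 2 * n ≤ imbalanceRatio D * n := by
  have : Nonempty (Fin M) := ⟨⟨0, hM⟩⟩
  obtain ⟨m, hm⟩ := exists_eq_ciInf_of_finite (f := classCount D)
  rw [imbalanceRatio_mul D hn, minorityCount, ← hm]
  have := mul_le_mul_of_nonneg_left (hcc m) (Nat.cast_nonneg (α := ℝ) M)
  linarith

/-- All class counts lie between `n * π₀ / 2` and `n`, so every acceptance probability is of order
`s / n`, and `s ≤ ρ n` keeps it below `1`. -/
lemma acceptProb_bounds (hM : 0 < M) (hn : 0 < n) {D : LabelledSample d M n} {π₀ s : ℝ}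
    (hπ₀ : 0 < π₀) (hcc : ∀ m, n * π₀ / 2 ≤ classCount D m) (hs : 0 ≤ s)
    (hsr : s ≤ imbalanceRatio D * n) (i : Fin n) :
    acceptProb D s i ∈ Set.Icc (0 : ℝ) 1 ∧ s / (M * n) ≤ acceptProb D s i ∧
      acceptProb D s i ≤ 2 * s / (M * π₀ * n) := by
  have hM' : (0 : ℝ) < M := by exact_mod_cast hM
  have hn' : (0 : ℝ) < n := by exact_mod_cast hn
  have hc := hcc (D i).2
  have hc0 : (0 : ℝ) < classCount D (D i).2 := lt_of_lt_of_le (by positivity) hc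
  have hcn : (classCount D (D i).2 : ℝ) ≤ n := by
    have h := Finset.single_le_sum (f := classCount D) (fun _ _ => Nat.zero_le _)
      (Finset.mem_univ (D i).2)
    rw [sum_classCount] at h
    exact_mod_cast h
  rw [imbalanceRatio_mul D hn] at hsr
  have hmin : (minorityCount D : ℝ) ≤ classCount D (D i).2 := by
    exact_mod_cast minorityCount_le D _
  refine ⟨⟨by unfold acceptProb; positivity, ?_⟩, ?_, ?_⟩
  · rw [acceptProb, div_le_one (by positivity)]
    exact hsr.trans (mul_le_mul_of_nonneg_left hmin hM'.le)
  · exact div_le_div_of_nonneg_left hs (by positivity) (mul_le_mul_of_nonneg_left hcn hM'.le)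
  · calc acceptProb D s i ≤ s / (M * (n * π₀ / 2)) :=
          div_le_div_of_nonneg_left hs (by positivity) (mul_le_mul_of_nonneg_left hc hM'.le)
      _ = _ := by field_simp

end

/-! ### From good samples to the regret bound -/

section

variable {d M : ℕ}

/-- A large `Λ`, that is a large window, serves two purposes: `hΛ1` puts `k` below half the expected
number of accepted points, and `hΛ2` makes the failure probability of a bag a high negative power of
`n`. -/
lemma eventually_bagLaw_bad_le {α : ℝ} (hα : 0 < α) (hd : 1 ≤ d) (hM : 0 < M) {p c π₀ Λ : ℝ}
    (hp : 0 < p) (hπ₀ : 0 < π₀) (hΛ : 0 < Λ) (hΛ1 : 4 / p ≤ Λ / (4 * M))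
    (hΛ2 : 16 * unionExponent d ≤ p * c / 2 * (Λ / (4 * M))) :
    ∃ K : ℝ, 0 < K ∧ ∀ᶠ n : ℕ in Filter.atTop, ∀ (D : LabelledSample d M n) (s : ℝ) (B k T : ℕ),
      1 ≤ s → 0 < B → (B : ℝ) ≤ n + 1 → (k : ℝ) ≤ 2 / p * (s * bandwidth d α n ^ d) →
      p * c / 2 * Real.log n ≤ s * bandwidth d α n ^ d → p * n / 2 ≤ B * s →
      (∀ i, acceptProb D s i ∈ Set.Icc (0 : ℝ) 1) →
      (∀ x, s * bandwidth d α n ^ d * (Λ / (4 * M)) ≤ ∑ i ∈ firstPoints D x T, acceptProb D s i) →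
      (∀ x, ∑ i ∈ firstPoints D x T, acceptProb D s i
        ≤ s * bandwidth d α n ^ d * (Λ / (M * π₀))) →
      (bagLaw D s B).real {z | ∃ x,
        (∃ b, ((firstPoints D x T).filter fun i => z b i = true).card < k) ∨
        ∃ m, K * (B * (s * bandwidth d α n ^ d * bandwidth d α n ^ α))
          ≤ |∑ b, bagDeviation D s k T x m (z b)|} ≤ 1 / (n : ℝ) ^ 2 := by
  have hM' : (0 : ℝ) < M := by exact_mod_cast hM
  set a := unionExponent d with ha
  set Λ' := Λ / (M * π₀) with hΛ'
  have hΛ'0 : 0 < Λ' := by positivity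
  have ha0 : (0 : ℝ) < a := by simp [ha, unionExponent]; positivity
  -- Together with `B * s ≥ p * n / 2` and `bandwidth_identity`, this makes the deviation exponent
  -- at least `a * log n`. The bags enter only through the product `B * s`.
  set K := Real.sqrt (8 * Λ' * a / p) with hK
  have hK0 : 0 < K := Real.sqrt_pos.2 (by positivity)
  have hKsq : K ^ 2 = 8 * Λ' * a / p := Real.sq_sqrt (by positivity)
  refine ⟨K, hK0, ?_⟩
  filter_upwards [Filter.eventually_ge_atTop 4, Filter.eventually_ge_atTop (2 * M),
    eventually_bandwidth (d := d) hα hd (κ := 2 * Λ' / K) (R := 0) (by positivity)]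
    with n hn4 hnM ⟨_, hτ0, hτ1, _, hεκ, hlog, _, _, _, _⟩ D s B k T hs1 hB hBn hk hsL hBs hacc
      haW hAW
  have hn0 : 0 < n := by omega
  have hid := bandwidth_identity (d := d) hα (n := n) (by omega)
  set τ := bandwidth d α n with hτdef
  have hε0 : 0 < τ ^ α := Real.rpow_pos_of_pos hτ0 _
  set ε := τ ^ α with hεdef
  have hs0 : 0 < s := by linarith
  have hB' : (0 : ℝ) < B := by exact_mod_cast hB
  have hτd0 : 0 < τ ^ d := pow_pos hτ0 _
  set σ := s * τ ^ d with hσ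
  have hσ0 : 0 < σ := by positivity
  rw [le_div_iff₀ hK0] at hεκ
  have hbad := bagLaw_real_bad_le D hB k T hacc (a := σ * (Λ / (4 * M))) (A := σ * Λ')
    (t := K * (B * (σ * ε))) (by positivity) (by positivity) haW
    (by
      have := mul_le_mul_of_nonneg_left hΛ1 hσ0.le
      have h2 : 2 / p * σ = σ * (4 / p) / 2 := by ring
      linarith)
    hAW (by positivity)
    (by
      have := mul_le_mul_of_nonneg_left hεκ (by positivity : 0 ≤ B * σ)
      linarith)
  have he1 : Real.exp (-(σ * (Λ / (4 * M)) / 16)) ≤ 1 / (n : ℝ) ^ a := by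
    rw [← exp_neg_mul_log hn0, Real.exp_le_exp, neg_le_neg_iff]
    have h1 := mul_le_mul_of_nonneg_right hΛ2 hlog
    have h2 := mul_le_mul_of_nonneg_right hsL (by positivity : 0 ≤ Λ / (4 * M))
    linarith
  have he2 : Real.exp (-((K * (B * (σ * ε))) ^ 2 / (4 * (B * (σ * Λ'))))) ≤ 1 / (n : ℝ) ^ a := by
    rw [← exp_neg_mul_log hn0, Real.exp_le_exp, neg_le_neg_iff]
    have h1 : (K * (B * (σ * ε))) ^ 2 / (4 * (B * (σ * Λ'))) = 2 * a / p * ((B * s) * τ ^ d * ε ^ 2) := by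
      have : (K * (B * (σ * ε))) ^ 2 = K ^ 2 * (B * (σ * ε)) ^ 2 := by ring
      rw [this, hKsq, hσ]
      field_simp
      ring
    have h2 : p * n / 2 * (τ ^ d * ε ^ 2) ≤ B * s * (τ ^ d * ε ^ 2) :=
      mul_le_mul_of_nonneg_right hBs (by positivity)
    have h3 := mul_le_mul_of_nonneg_left h2 (by positivity : 0 ≤ 2 * a / p)
    have h4 : 2 * a / p * (p * n / 2 * (τ ^ d * ε ^ 2)) = a * (n * τ ^ d * ε ^ 2) := by
      field_simp
    rw [h4, hid] at h3
    rw [h1]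
    linarith
  refine hbad.trans (le_trans ?_ (bag_union_bound d hn4 hnM hBn))
  gcongr

/-- Given a good sample, the under-bagging classifier has small regret with high probability. -/
lemma eventually_regret_of_goodSample (hd : 1 ≤ d) (hM : 2 ≤ M)
    (P : Measure (EuclideanSpace ℝ (Fin d) × Fin M)) [IsProbabilityMeasure P]
    (hPX : P.fst = (volume : Measure (EuclideanSpace ℝ (Fin d))).restrict (unitCube d))
    {π₀ : ℝ} (hπ₀ : 0 < π₀) (hπ : ∀ m, π₀ ≤ classProb P m)
    (η : EuclideanSpace ℝ (Fin d) → Fin M → ℝ) (hη : IsPosterior P η)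
    {α cL β cβ : ℝ} (hα : 0 < α) (hcL : 0 < cL) (hcβ : 0 < cβ)
    (hHolder : HolderPosterior η α cL) (hMargin : MarginCondition hM P η β cβ)
    {c p lam KD : ℝ} (hp : 0 < p) (hlam : 0 < lam) (hKD : 0 < KD)
    (hΛ1 : 4 / p ≤ (lam / (2 * d)) ^ d / (4 * M))
    (hΛ2 : 16 * unionExponent d ≤ p * c / 2 * ((lam / (2 * d)) ^ d / (4 * M))) :
    ∃ C : ℝ, 0 < C ∧ ∀ᶠ n : ℕ in Filter.atTop, ∀ (D : LabelledSample d M n) (s : ℝ) (B k : ℕ),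
      GoodSample P D (lam * bandwidth d α n)
        (KD * (n * bandwidth d α n ^ d * bandwidth d α n ^ α)) (KD * bandwidth d α n ^ α) →
      1 ≤ s → s ≤ imbalanceRatio D * n → 0 < k → 0 < B → (B : ℝ) ≤ n + 1 →
      (k : ℝ) ≤ 2 / p * (s * bandwidth d α n ^ d) → s * bandwidth d α n ^ d / 4 ≤ k →
      p * c / 2 * Real.log n ≤ s * bandwidth d α n ^ d → p * n / 2 ≤ B * s →
      (bagLaw D s B).real {z | ¬ ∀ f, IsUnderBaggingClassifier D z k f →
        amRegret P f ≤ C * (Real.log n / n) ^ (α * (β + 1) / (2 * α + d))} ≤ 1 / (n : ℝ) ^ 2 := by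
  have hM0 : 0 < M := by omega
  have hM' : (0 : ℝ) < M := by exact_mod_cast hM0
  have hd' : (0 : ℝ) < d := by exact_mod_cast hd
  have hω := unitBallVolume_pos d
  set Λ := (lam / (2 * d)) ^ d with hΛ
  have hΛ0 : 0 < Λ := by positivity
  obtain ⟨KZ, hKZ, hbags⟩ := eventually_bagLaw_bad_le (c := c) hα hd hM0 hp hπ₀ hΛ0 hΛ1 hΛ2
  set vb := lam ^ d * unitBallVolume d with hvb
  set C₁ := KZ + 1 / M * (2 * (KD + cL * lam ^ α * vb) / π₀ + 2 * vb * KD / π₀ ^ 2) with hC₁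
  have hlamα : 0 < lam ^ α := Real.rpow_pos_of_pos hlam _
  have hC₁0 : 0 < C₁ := by positivity
  set C₂ := (1 + M) * C₁ * 4 with hC₂
  have hC₂0 : 0 < C₂ := by positivity
  refine ⟨(2 * C₂ / π₀) * (cβ * (2 * C₂) ^ β), by positivity, ?_⟩
  have hcont := hHolder.continuousOn hα
  filter_upwards [hbags, eventually_bandwidth (d := d) hα hd
    (κ := min (1 / lam) (min (π₀ / (2 * KD)) (Λ / (2 * M * KD)))) (R := 4 / Λ) (by positivity)]
    with n hbag ⟨hn2, hτ0, hτ1, hτκ, hεκ, hlog, _, hL2, _, _⟩ D s B k hD hs1 hsr hk0 hB hBn hk hk4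
      hsL hBs
  have hn0 : 0 < n := by omega
  have hn' : (0 : ℝ) < n := by exact_mod_cast hn0
  set τ := bandwidth d α n with hτdef
  have hε0 : 0 < τ ^ α := Real.rpow_pos_of_pos hτ0 _
  have hrate : (Real.log n / n) ^ (α * (β + 1) / (2 * α + d)) = (τ ^ α) ^ (β + 1) := by
    rw [← bandwidth_rpow hn2, Real.rpow_mul hτ0.le]
  have hpowα : (lam * τ) ^ α = lam ^ α * τ ^ α := Real.mul_rpow hlam.le hτ0.le
  set ε := τ ^ α with hεdef
  have hτd0 : 0 < τ ^ d := pow_pos hτ0 _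
  have hs0 : 0 < s := by linarith
  have hB' : (0 : ℝ) < B := by exact_mod_cast hB
  have hk' : (0 : ℝ) < k := by exact_mod_cast hk0
  have hh1 : lam * τ ≤ 1 := by
    have := hτκ.trans (min_le_left _ _)
    rwa [le_div_iff₀ hlam, mul_comm] at this
  have hδ : KD * ε ≤ π₀ / 2 := by
    have := hεκ.trans ((min_le_right _ _).trans (min_le_left _ _))
    rw [le_div_iff₀ (by positivity)] at this
    linarith
  have hεΛ : M * (KD * ε) ≤ Λ / 2 := by
    have := hεκ.trans ((min_le_right _ _).trans (min_le_right _ _))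
    rw [le_div_iff₀ (by positivity)] at this
    linarith
  have hcc := le_classCount_of_freq hπ hD.classFreq hδ
  have hacc := fun i => acceptProb_bounds hM0 hn0 hπ₀ hcc hs0.le hsr i
  -- Half the mean number of points guaranteed in a ball of radius `lam * τ` around a point of the
  -- cube; the other half pays for the deviations of the `M` class counts. Hence the first `T`
  -- points lie in that ball.
  set T := ⌊n * τ ^ d * Λ / 2⌋₊ with hT
  have hT1 : (T : ℝ) ≤ n * τ ^ d * Λ / 2 := Nat.floor_le (by positivity)
  have hT2 : n * τ ^ d * Λ / 4 ≤ T := by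
    have h1 := Nat.lt_floor_add_one (n * τ ^ d * Λ / 2)
    have h2 : 4 ≤ n * τ ^ d * Λ := by
      have := hlog.trans hL2
      rwa [div_le_iff₀ hΛ0] at this
    linarith
  have hTball : ∀ x ∈ unitCube d, (T : ℝ) ≤ ∑ m, sampleCount D m (Metric.ball x (lam * τ)) := by
    intro x hx
    have h1 : ∑ m, (n * labelMass P m (Metric.ball x (lam * τ)) - KD * (n * τ ^ d * ε))
        ≤ ∑ m, sampleCount D m (Metric.ball x (lam * τ)) :=
      Finset.sum_le_sum fun m _ => (hD.ballCount x hx _ (by positivity) le_rfl m).2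
    rw [Finset.sum_sub_distrib, ← Finset.mul_sum, sum_labelMass P measurableSet_ball] at h1
    have h2 := le_fst_real_ball hPX hd hx (r := lam * τ) (by positivity) hh1
    have h3 : (lam * τ / (2 * d)) ^ d = Λ * τ ^ d := by
      rw [hΛ, ← mul_pow]
      congr 1
      ring
    rw [h3] at h2
    have h4 := mul_le_mul_of_nonneg_left h2 hn'.le
    have h5 := mul_le_mul_of_nonneg_left hεΛ (by positivity : 0 ≤ n * τ ^ d)
    simp only [Finset.sum_const, Finset.card_univ, Fintype.card_fin, nsmul_eq_mul] at h1
    linarith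
  have hTn : T ≤ n := by
    have h0 : (0 : EuclideanSpace ℝ (Fin d)) ∈ unitCube d := fun i => by simp
    exact (dist_le_of_mem_firstPoints D (hTball 0 h0)).2
  have haW : ∀ x, s * τ ^ d * (Λ / (4 * M)) ≤ ∑ i ∈ firstPoints D x T, acceptProb D s i := by
    intro x
    have h1 := Finset.card_nsmul_le_sum (firstPoints D x T) (acceptProb D s) (s / (M * n))
      fun i _ => (hacc i).2.1
    rw [card_firstPoints D x hTn, nsmul_eq_mul] at h1
    refine le_trans ?_ h1
    have h2 := mul_le_mul_of_nonneg_right hT2 (by positivity : 0 ≤ s / (M * n))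
    have h3 : n * τ ^ d * Λ / 4 * (s / (M * n)) = s * τ ^ d * (Λ / (4 * M)) := by
      field_simp
    linarith
  have hAW : ∀ x, ∑ i ∈ firstPoints D x T, acceptProb D s i ≤ s * τ ^ d * (Λ / (M * π₀)) := by
    intro x
    have h1 := Finset.sum_le_card_nsmul (firstPoints D x T) (acceptProb D s)
      (2 * s / (M * π₀ * n)) fun i _ => (hacc i).2.2
    rw [card_firstPoints D x hTn, nsmul_eq_mul] at h1
    refine h1.trans ?_
    have h2 := mul_le_mul_of_nonneg_right hT1 (by positivity : 0 ≤ 2 * s / (M * π₀ * n))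
    have h3 : n * τ ^ d * Λ / 2 * (2 * s / (M * π₀ * n)) = s * τ ^ d * (Λ / (M * π₀)) := by
      field_simp
    linarith
  refine (measureReal_mono ?_).trans
    (hbag D s B k T hs1 hB hBn hk hsL hBs (fun i => (hacc i).1) haW hAW)
  intro z hz
  by_contra hgood
  refine hz fun f hf => ?_
  have hgood' : ∀ x, (∀ b, k ≤ ((firstPoints D x T).filter fun i => z b i = true).card) ∧
      ∀ m, |∑ b, bagDeviation D s k T x m (z b)| ≤ KZ * (B * (s * τ ^ d * ε)) := by
    intro x
    refine ⟨fun b => ?_, fun m => ?_⟩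
    · by_contra h
      exact hgood ⟨x, Or.inl ⟨b, not_le.1 h⟩⟩
    · by_contra h
      exact hgood ⟨x, Or.inr ⟨m, (not_le.1 h).le⟩⟩
  have hest : ∀ x ∈ unitCube d, ∀ m,
      |baggedEstimate D z k x m - weightedPosterior P η x m| ≤ C₂ * ε := by
    intro x hx m
    refine (abs_baggedEstimate_sub_le P hPX hd hM0 η hη hα hcL hHolder hπ₀ hπ hn0 D hk0 hB hx z
      (hgood' x).1 (by positivity) (by positivity) hs0.le
      (dist_le_of_mem_firstPoints D (hTball x hx)).1 (hD.ballCount x hx) hD.classFreq hδ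
      (hgood' x).2 m).trans ?_
    rw [hpowα, mul_pow]
    -- Bag deviation, ball counts, Hölder bias and class frequencies all contribute at the common
    -- order `s * τ ^ d * ε`; dividing by `k`, which is at least `s * τ ^ d / 4`, leaves order `ε`.
    have h1 : KZ * (B * (s * τ ^ d * ε)) / B + s / M * (2 * (KD * (n * τ ^ d * ε)
        + n * (cL * (lam ^ α * ε) * (lam ^ d * τ ^ d * unitBallVolume d))) / (n * π₀)
        + 2 * (lam ^ d * τ ^ d * unitBallVolume d) * (KD * ε) / π₀ ^ 2)
        = C₁ * ε * (s * τ ^ d) := by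
      rw [hC₁, hvb]
      field_simp
    rw [h1, div_le_iff₀ hk', hC₂]
    have h2 := mul_le_mul_of_nonneg_left hk4 (by positivity : 0 ≤ (1 + M) * C₁ * 4 * ε)
    linarith
  have hreg := amRegret_le hM P hPX hπ₀ hπ η hη hcont hcβ hMargin (δ := C₂ * ε) (by positivity)
    (baggedEstimate D z k) hest f hf.1 hf.2
  rw [hrate]
  refine hreg.trans (le_of_eq ?_)
  rw [Real.rpow_add hε0, Real.rpow_one, ← mul_assoc 2 C₂ ε,
    Real.mul_rpow (by positivity : 0 ≤ 2 * C₂) hε0.le]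
  ring

/-- A lower bound on an iterated probability from bounds on its two stages; no measurability in
the first stage is needed. -/
lemma ofReal_le_lintegral_of_bad {Ω : Type*} [MeasurableSpace Ω] (μ : Measure Ω)
    [IsProbabilityMeasure μ] (G : Set Ω) {δ : ℝ} (hδ0 : 0 ≤ δ) (hG : μ.real Gᶜ ≤ δ)
    (F : Ω → ℝ≥0∞) (hF : ∀ ω ∈ G, ENNReal.ofReal (1 - δ) ≤ F ω) (hδ1 : δ ≤ 1) :
    ENNReal.ofReal (1 - 5 * δ) ≤ ∫⁻ ω, F ω ∂μ := by
  set H := (toMeasurable μ Gᶜ)ᶜ with hH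
  have hHm : MeasurableSet H := (measurableSet_toMeasurable _ _).compl
  have hHG : H ⊆ G := by
    intro ω hω
    by_contra h
    exact hω (subset_toMeasurable _ _ h)
  have hHμ : ENNReal.ofReal (1 - δ) ≤ μ H := by
    rw [ENNReal.ofReal_le_iff_le_toReal (measure_ne_top _ _), ← measureReal_def, hH,
      probReal_compl_eq_one_sub (measurableSet_toMeasurable _ _), measureReal_def,
      measure_toMeasurable, ← measureReal_def]
    linarith
  -- The two stages cost `2 * δ`; the constant `5` leaves slack.
  calc ENNReal.ofReal (1 - 5 * δ) ≤ ENNReal.ofReal ((1 - δ) * (1 - δ)) :=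
        ENNReal.ofReal_le_ofReal (by nlinarith [sq_nonneg δ])
    _ = ENNReal.ofReal (1 - δ) * ENNReal.ofReal (1 - δ) := ENNReal.ofReal_mul (by linarith)
    _ ≤ ENNReal.ofReal (1 - δ) * μ H := by gcongr
    _ = ∫⁻ _ in H, ENNReal.ofReal (1 - δ) ∂μ := by rw [setLIntegral_const]
    _ ≤ ∫⁻ ω in H, F ω ∂μ := setLIntegral_mono' hHm fun ω hω => hF ω (hHG hω)
    _ ≤ ∫⁻ ω, F ω ∂μ := setLIntegral_le_lintegral _ _

end

end

/-! ### Choice of the constants and combination of the two stages -/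

theorem theorem3
    (d M : ℕ) (hd : 1 ≤ d) (hM : 2 ≤ M)
    (P : Measure (EuclideanSpace ℝ (Fin d) × Fin M)) [IsProbabilityMeasure P]
    -- the marginal distribution of the features is uniform on the cube
    (hPX : P.fst = (volume : Measure (EuclideanSpace ℝ (Fin d))).restrict (unitCube d))
    (hP : ∀ m, 0 < classProb P m)
    (η : EuclideanSpace ℝ (Fin d) → Fin M → ℝ) (hη : IsPosterior P η)
    (α cL β cβ : ℝ) (hα : 0 < α) (hcL : 0 < cL) (hβ : 0 < β) (hcβ : 0 < cβ)
    (hHolder : HolderPosterior η α cL) (hMargin : MarginCondition hM P η β cβ)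
    -- the constant in the lower bound on the expected subsample size
    (c : ℝ) (hc : 0 < c) :
    ∃ C : ℝ, 0 < C ∧ ∃ N : ℕ, ∀ n : ℕ, N ≤ n →
      -- the parameters may depend on the sample; they are chosen as prescribed for every
      -- sample for which such a choice exists
      ∀ (s : LabelledSample d M n → ℝ) (B k : LabelledSample d M n → ℕ),
        (∀ D : LabelledSample d M n,
          (∃ (s' : ℝ) (B' k' : ℕ),
            IsParameterChoice d α c (imbalanceRatio D * n) s' B' k') →
          IsParameterChoice d α c (imbalanceRatio D * n) (s D) (B D) (k D)) →
        ENNReal.ofReal (1 - 5 / (n : ℝ) ^ 2) ≤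
          ∫⁻ D : LabelledSample d M n,
            bagLaw D (s D) (B D)
              {z | ∀ f, IsUnderBaggingClassifier D z (k D) f →
                amRegret P f ≤ C * (Real.log n / n) ^ (α * (β + 1) / (2 * α + d))}
            ∂(Measure.pi fun _ : Fin n => P) := by
  have hM0 : 0 < M := by omega
  have hM' : (0 : ℝ) < M := by exact_mod_cast hM0
  have hd' : (0 : ℝ) < d := by exact_mod_cast hd
  obtain ⟨m₀, -, hm₀⟩ := Finset.exists_min_image (Finset.univ : Finset (Fin M)) (classProb P)
    ⟨⟨0, hM0⟩, Finset.mem_univ _⟩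
  set π₀ := classProb P m₀ with hπ₀def
  have hπ₀ : 0 < π₀ := hP m₀
  have hπ : ∀ m, π₀ ≤ classProb P m := fun m => hm₀ m (Finset.mem_univ m)
  -- Lower bound for the imbalance ratio on good samples, where every class has at least `n * π₀ /
  -- 2` points.
  set p : ℝ := M * π₀ / 2 with hp
  have hp0 : 0 < p := by positivity
  have hp1 : p ≤ 1 := by
    have h : ∑ _m : Fin M, π₀ ≤ ∑ m, classProb P m := Finset.sum_le_sum fun m _ => hπ m
    rw [sum_classProb] at h
    simp only [Finset.sum_const, Finset.card_univ, Fintype.card_fin, nsmul_eq_mul] at h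
    rw [hp]
    linarith
  -- The two summands are the thresholds required by `hΛ1` and `hΛ2`. The radius factor `lam` is
  -- fixed from them first; the deviation constant `KD` then depends on `lam`, and `C` on both.
  set Λ₀ : ℝ := 4 * M * (4 / p) + 4 * M * (16 * unionExponent d / (p * c / 2)) with hΛ₀
  have hΛ₀0 : 0 ≤ Λ₀ := by positivity
  set lam : ℝ := 2 * d * (1 + Λ₀) with hlam
  have hlam0 : 0 < lam := by positivity
  have hΛ : Λ₀ ≤ (lam / (2 * d)) ^ d := by
    have h1 : lam / (2 * d) = 1 + Λ₀ := by rw [hlam]; field_simp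
    rw [h1]
    calc Λ₀ ≤ (1 + Λ₀) ^ 1 := by rw [pow_one]; linarith
      _ ≤ (1 + Λ₀) ^ d := pow_le_pow_right₀ (by linarith) hd
  have hΛ1 : 4 / p ≤ (lam / (2 * d)) ^ d / (4 * M) := by
    rw [le_div_iff₀ (by positivity), mul_comm]
    refine le_trans ?_ hΛ
    rw [hΛ₀, le_add_iff_nonneg_right]
    positivity
  have hΛ2 : 16 * unionExponent d ≤ p * c / 2 * ((lam / (2 * d)) ^ d / (4 * M)) := by
    rw [← div_le_iff₀' (by positivity), le_div_iff₀ (by positivity), mul_comm]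
    refine le_trans ?_ hΛ
    rw [hΛ₀, le_add_iff_nonneg_left]
    positivity
  obtain ⟨KD, hKD, hsample⟩ := eventually_goodSample P hPX hd hα hlam0
  obtain ⟨C, hC, hregret⟩ := eventually_regret_of_goodSample hd hM P hPX hπ₀ hπ η hη hα hcL hcβ
    hHolder hMargin hp0 hlam0 hKD hΛ1 hΛ2
  refine ⟨C, hC, ?_⟩
  obtain ⟨N, hN⟩ := Filter.eventually_atTop.1 (hsample.and (hregret.and
    ((eventually_parameterChoice hα hd hc hp0 hp1).and (eventually_bandwidth (d := d) hα hd
      (κ := π₀ / (2 * KD)) (R := 0) (by positivity)))))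
  refine ⟨N, fun n hn s B k hchoice => ?_⟩
  obtain ⟨hs, hr, hpar, hn2, -, -, -, hε, -⟩ := hN n hn
  have hn0 : 0 < n := by omega
  have hδ : KD * bandwidth d α n ^ α ≤ π₀ / 2 := by
    rw [le_div_iff₀ (by positivity)] at hε
    linarith
  have hn1 : (1 : ℝ) ≤ (n : ℝ) ^ 2 := one_le_pow₀ (by exact_mod_cast hn0)
  rw [div_eq_mul_one_div]
  refine ofReal_le_lintegral_of_bad _ {D | GoodSample P D (lam * bandwidth d α n)
    (KD * (n * bandwidth d α n ^ d * bandwidth d α n ^ α)) (KD * bandwidth d α n ^ α)}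
    (by positivity) hs _ (fun D hD => ?_) (by rw [div_le_one (by positivity)]; exact hn1)
  have hcc := le_classCount_of_freq hπ hD.classFreq hδ
  -- On a good sample an admissible choice exists, so `hchoice` forces the given parameters to be
  -- admissible.
  obtain ⟨hex, hall⟩ := hpar (imbalanceRatio D * n) (le_imbalanceRatio_mul hM0 hn0 hcc)
    (imbalanceRatio_mul_le D hn0)
  obtain ⟨h1, h2, h3, h4, h5, h6, h7, h8, h9⟩ := hall _ _ _ (hchoice D hex)
  have hbad := hr D (s D) (B D) (k D) hD h1 h2 h3 h4 h5 h6 h7 h8 h9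
  rw [ENNReal.ofReal_le_iff_le_toReal (measure_ne_top _ _), ← measureReal_def]
  have hcompl := probReal_compl_eq_one_sub (μ := bagLaw D (s D) (B D))
    (Set.Finite.measurableSet (Set.toFinite {z | ∀ f, IsUnderBaggingClassifier D z (k D) f →
      amRegret P f ≤ C * (Real.log n / n) ^ (α * (β + 1) / (2 * α + d))}))
  rw [Set.compl_ofPred] at hcompl
  linarith
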